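/- Let $N\ge 1$, $\beta>0$ and $\gamma\ge 0$, and take all indices modulo $N$. Let $\vec Y=(Y_1,\dots,Y_N)$ be a random vector in $[0,1]^N$ with density $$f_{\vec Y}(\vec y)=\frac{1}{Z_N}\exp\Big(-\sum_{i=1}^{N}\Big(\frac{\beta}{2y_i}+\frac{\gamma}{y_i+y_{i+1}}\Big)\Big),\qquad Z_N=\int_{[0,1]^N}\exp\Big(-\sum_{i=1}^{N}\Big(\frac{\beta}{2y_i}+\frac{\gamma}{y_i+y_{i+1}}\Big)\Big)\,d\vec y,$$ where the exponential is read as $0$ if some $y_i=0$. For $S\subset\{1,\dots,N\}$ let $f_{\vec Y_S}$ be the marginal density of $\vec Y_S=(Y_i)_{i\in S}$, obtained by integrating $f_{\vec Y}$ over the remaining coordinates in $[0,1]$, and for disjoint $I,J$ let $f_{\vec Y_I|\vec Y_J=\vec y_J}(\vec y_I)=f_{\vec Y_{I\cup J}}(\vec y_I,\vec y_J)/f_{\vec Y_J}(\vec y_J)$. Blocks of consecutive indices are understood cyclically ($N$ and $1$ are neighbours), and for non-empty disjoint blocks $I,J$ let $r(I,J)\ge 0$ be the smaller of the numbers of indices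 in the two (possibly empty) blocks that separate $I$ from $J$ around the circle. Then there exist positive constants $C=C(\beta,\gamma)$, depending only on $\beta$ and $\gamma$, and $\alpha=\alpha(\gamma)$, depending only on $\gamma$, such that for all $\beta>0$, $\gamma\ge0$, all $N$, all non-empty disjoint blocks $I,J\subset\{1,\dots,N\}$ of consecutive indices, and all $\vec y_I\in[0,1]^{|I|}$ and $\vec y_J\in(0,1]^{|J|}$, one has $f_{\vec Y_J}(\vec y_J)>0$ (so that the conditional density is defined) and $$\Big|f_{\vec Y_I|\vec Y_J=\vec y_J}(\vec y_I)-f_{\vec Y_I}(\vec y_I)\Big|\le C\,e^{-\alpha\, r(I,J)}\,f_{\vec Y_I}(\vec y_I).$$ Moreover, $\alpha(\gamma)\to\infty$ as $\gamma\downarrow 0$. -/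

import Mathlib

open Filter Topology

noncomputable section

namespace CoulombChain

/-- The circular energy `∑ i, (β / (2 yᵢ) + γ / (yᵢ + yᵢ₊₁))`, with the indices taken modulo `N`. -/
def energy {N : ℕ} [NeZero N] (β γ : ℝ) (y : ZMod N → ℝ) : ℝ :=
  ∑ i : ZMod N, (β / (2 * y i) + γ / (y i + y (i + 1)))

/-- The Gibbs weight `exp (-energy)`, with its limit value `exp (-∞) = 0` at the points of the
unit cube that have a vanishing coordinate. -/
def weight {N : ℕ} [NeZero N] (β γ : ℝ) : (ZMod N → ℝ) → ℝ :=
  Set.indicator {y | ∀ i, 0 < y i} (fun y => Real.exp (-energy β γ y))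

/-- The normalising constant `Z_N`, the integral of the Gibbs weight over `[0,1]^N`. -/
def partitionFunction (N : ℕ) [NeZero N] (β γ : ℝ) : ℝ :=
  ∫ y in Set.Icc (0 : ZMod N → ℝ) 1, weight β γ y

/-- The density of `Y` at a point `y` of `[0,1]^N`. -/
def density {N : ℕ} [NeZero N] (β γ : ℝ) (y : ZMod N → ℝ) : ℝ :=
  weight β γ y / partitionFunction N β γ

/-- The marginal density of `Y_S = (Y_i)_{i ∈ S}` at the point `y_S = (y_i)_{i ∈ S}`: the
coordinates outside `S` are integrated out over `[0,1]`. The values of `y` outside `S` play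
no role, since they are overwritten by the integration variable `u`. -/
def marginalDensity {N : ℕ} [NeZero N] (β γ : ℝ) (S : Finset (ZMod N)) (y : ZMod N → ℝ) : ℝ :=
  ∫ u in Set.Icc (0 : ↥Sᶜ → ℝ) 1, density β γ (Function.updateFinset y Sᶜ u)

/-- The conditional density of `Y_I` at `y_I` given `Y_J = y_J`, for disjoint `I` and `J`. -/
def conditionalDensity {N : ℕ} [NeZero N] (β γ : ℝ) (I J : Finset (ZMod N))
    (y : ZMod N → ℝ) : ℝ :=
  marginalDensity β γ (I ∪ J) y / marginalDensity β γ J y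

/-- `S` consists of consecutive indices modulo `N`: `S = {a, a + 1, …, a + (n - 1)}`. -/
def IsBlock {N : ℕ} [NeZero N] (S : Finset (ZMod N)) : Prop :=
  ∃ (a : ZMod N) (n : ℕ), S = (Finset.range n).image (fun k : ℕ => a + (k : ZMod N))

/-- The smallest number `n` of consecutive indices between `I` and `J` around the circle: the
indices strictly between `i` and `i + (n + 1)` are `i + 1, …, i + n`. -/
def separation {N : ℕ} [NeZero N] (I J : Finset (ZMod N)) : ℕ :=
  sInf {n : ℕ | ∃ i ∈ I, ∃ j ∈ J, j = i + ((n + 1 : ℕ) : ZMod N) ∨ i = j + ((n + 1 : ℕ) : ZMod N)}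

end CoulombChain

end

noncomputable section

namespace CoulombChain

open MeasureTheory Set
open scoped ENNReal NNReal

/-! The chain is a transfer-operator model. Integrating out both gaps turns the joint weight `F` of
the two blocks into a product of two block factors and two kernels `bridge`, one per gap
(`lmarginal_gaps_chainWeight`). The blocks would be independent if each kernel were a product of a
function of one end and a function of the other, so the dependence is measured by the cross-ratios
`T x z * T x' z' / (T x z' * T x' z)`.

For a gap of one site these are at most `(minorization γ)⁻¹ ^ 2`: the kernel lies between
`minorization γ * ∫ exp (-β / (2 y))` and `∫ exp (-β / (2 y))`. The lower bound is Chebyshev's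
inequality for increasing functions and makes every constant independent of `β` (`le_bridge_one`).
Composing with a kernel of cross-ratios at most `1 + q` multiplies the excess `δ` by `q / (2 + q) <
1`, as in Birkhoff's contraction theorem (`CrossRatioLE.comp_contraction`). Hence the excess decays
geometrically in the gap length (`crossRatioLE_bridge`).

To pass to densities, let `w` be an independent copy of the configuration on `I ∪ J`. Then `Z * F y`
is the integral over `w` of `F w * F y`, while the product of the two marginal weights is the
integral of `F (y_I, w_J) * F (w_I, y_J)`. The block factors agree, so the integrands differ only by
cross-ratios of the two gaps (`unnormalizedMarginal_mul_le_swap`).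

A gap without sites is a single bond, whose cross-ratios are unbounded if `γ > 0`. At separation `0`
an upper bound on the joint weight suffices; it follows after weighting `w` by `exp (-γ / ·)` at the
four block ends, which costs a constant by Chebyshev's inequality
(`minorization_pow_mul_lmarginal_le`). Finally, `minorization γ` tends to `1` as `γ ↓ 0`, so the
contraction factor tends to `0` and the rate to infinity. -/

/-! ### Inequalities for integrals -/

/-- The product of two integrals as a symmetrised double integral. -/
theorem lintegral_mul_lintegral_symm {μ : Measure ℝ} {f g : ℝ → ℝ≥0∞} (hf : Measurable f)
    (hg : Measurable g) :
    2 * ((∫⁻ y, f y ∂μ) * ∫⁻ y, g y ∂μ) = ∫⁻ y, ∫⁻ y', (f y * g y' + f y' * g y) ∂μ ∂μ := by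
  have (x : ℝ) : ∫⁻ y, (f x * g y + f y * g x) ∂μ
      = f x * (∫⁻ y, g y ∂μ) + (∫⁻ y, f y ∂μ) * g x := by
    rw [lintegral_add_left (by fun_prop), lintegral_const_mul _ hg, lintegral_mul_const _ hf]
  simp_rw [this]
  rw [lintegral_add_left (by fun_prop), lintegral_mul_const _ hf, lintegral_const_mul _ hg,
    two_mul]

/-- Chebyshev's association inequality for monotone functions under a probability measure. -/
theorem lintegral_mul_lintegral_le_of_monotone {μ : Measure ℝ} [IsProbabilityMeasure μ]
    {f g : ℝ → ℝ≥0∞} (hf : Monotone f) (hg : Monotone g) :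
    (∫⁻ x, f x ∂μ) * ∫⁻ x, g x ∂μ ≤ ∫⁻ x, f x * g x ∂μ := by
  have hfm := hf.measurable
  have hgm := hg.measurable
  -- Rearrangement inequality. Since `ℝ≥0∞` has no usable subtraction, the larger values are written
  -- as the smaller ones plus `d` and `e`.
  have swap (x y : ℝ) : f x * g y + f y * g x ≤ f x * g x + f y * g y := by
    rcases le_total x y with h | h
    · obtain ⟨d, hd⟩ := exists_add_of_le (hf h)
      obtain ⟨e, he⟩ := exists_add_of_le (hg h)
      rw [hd, he]
      calc _ = f x * g x + (f x + d) * g x + f x * e := by ring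
        _ ≤ f x * g x + (f x + d) * g x + (f x + d) * e := by gcongr; exact le_self_add
        _ = _ := by ring
    · obtain ⟨d, hd⟩ := exists_add_of_le (hf h)
      obtain ⟨e, he⟩ := exists_add_of_le (hg h)
      rw [hd, he]
      calc _ = f y * g y + (f y + d) * g y + f y * e := by ring
        _ ≤ f y * g y + (f y + d) * g y + (f y + d) * e := by gcongr; exact le_self_add
        _ = _ := by ring
  have key : ∫⁻ x, ∫⁻ y, (f x * g y + f y * g x) ∂μ ∂μ
      ≤ ∫⁻ x, ∫⁻ y, (f x * g x + f y * g y) ∂μ ∂μ :=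
    lintegral_mono fun x => lintegral_mono fun y => swap x y
  have hr : ∫⁻ x, ∫⁻ y, (f x * g x + f y * g y) ∂μ ∂μ = 2 * ∫⁻ x, f x * g x ∂μ := by
    have (x : ℝ) : ∫⁻ y, (f x * g x + f y * g y) ∂μ = f x * g x + ∫⁻ y, f y * g y ∂μ := by
      rw [lintegral_add_left (by fun_prop)]; simp
    simp_rw [this]
    rw [lintegral_add_left (by fun_prop)]
    simp [two_mul]
  rw [← lintegral_mul_lintegral_symm hfm hgm, hr] at key
  exact (ENNReal.mul_le_mul_iff_right (by simp) (by simp)).1 key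

/-- Pointwise form of the contraction of cross-ratios: if `a, b` agree up to a factor `1 + δ` and
`s, s'` up to a factor `1 + q`, then the symmetrised products agree up to `1 + δ q / (2 + q)`. -/
theorem mul_add_mul_le_contraction {a b s s' δ q : ℝ≥0} (hab : a ≤ (1 + δ) * b)
    (hba : b ≤ (1 + δ) * a) (hss : s ≤ (1 + q) * s') (hss' : s' ≤ (1 + q) * s) :
    a * s + b * s' ≤ (1 + δ * (q / (2 + q))) * (a * s' + b * s) := by
  have main (A B S S' D Q : ℝ) (hB : 0 ≤ B) (hS' : 0 ≤ S') (hD : 0 ≤ D) (hQ : 0 ≤ Q) (hBA : B ≤ A)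
      (hAB : A ≤ (1 + D) * B) (hS : S' ≤ S) (hSS : S ≤ (1 + Q) * S') :
      A * S + B * S' ≤ (1 + D * (Q / (2 + Q))) * (A * S' + B * S) := by
    have h2 : 0 < 2 + Q := by linarith
    -- Twice `h1` plus `h3` bounds `(2 + Q) * (A - B) * (S - S')` by `D * Q * B * (S + S')`, and
    -- `h4` replaces `B * S'` by `A * S'`. The extremal case `A = (1 + D) * B`, `S = (1 + Q) * S'`
    -- gives the sharper factor `Q / (2 + Q + D)`; dropping `D` makes the rate uniform under
    -- iteration.
    have h1 : (A - B) * (S - S') ≤ (D * B) * (Q * S') :=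
      mul_le_mul (by linarith) (by linarith) (by linarith) (by positivity)
    have h3 : Q * ((A - B) * (S - S')) ≤ Q * ((D * B) * (S - S')) :=
      mul_le_mul_of_nonneg_left
        (mul_le_mul_of_nonneg_right (by linarith) (by linarith)) hQ
    have h4 : 0 ≤ D * Q * ((A - B) * S') :=
      mul_nonneg (mul_nonneg hD hQ) (mul_nonneg (by linarith) hS')
    rw [← sub_nonneg]
    have : (1 + D * (Q / (2 + Q))) * (A * S' + B * S) - (A * S + B * S')
        = (D * Q * (A * S' + B * S) - (2 + Q) * ((A - B) * (S - S'))) / (2 + Q) := by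
      field_simp; ring
    rw [this]
    apply div_nonneg _ h2.le
    nlinarith
  -- When the pairs are oppositely ordered, rearrangement gives the bound even with constant `1`.
  have triv (A B S S' D Q : ℝ) (hA : 0 ≤ A) (hB : 0 ≤ B) (hS : 0 ≤ S) (hS' : 0 ≤ S') (hD : 0 ≤ D)
      (hQ : 0 ≤ Q) (h : (A - B) * (S - S') ≤ 0) :
      A * S + B * S' ≤ (1 + D * (Q / (2 + Q))) * (A * S' + B * S) := by
    have : 0 ≤ D * (Q / (2 + Q)) * (A * S' + B * S) := by positivity
    nlinarith
  rw [← NNReal.coe_le_coe] at *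
  push_cast at *
  have ha := a.2
  have hb := b.2
  have hs := s.2
  have hs' := s'.2
  rcases le_total (b : ℝ) a with h | h <;> rcases le_total (s' : ℝ) s with k | k
  · exact main _ _ _ _ _ _ hb hs' δ.2 q.2 h hab k hss
  · exact triv _ _ _ _ _ _ ha hb hs hs' δ.2 q.2
      (mul_nonpos_of_nonneg_of_nonpos (by linarith) (by linarith))
  · exact triv _ _ _ _ _ _ ha hb hs hs' δ.2 q.2
      (mul_nonpos_of_nonpos_of_nonneg (by linarith) (by linarith))
  · have := main _ _ _ _ _ _ ha hs δ.2 q.2 h hba k hss'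
    rwa [add_comm (a * s' : ℝ), add_comm (a * s : ℝ)]

/-! ### Cross-ratios of kernels -/

/-- The cross-ratios of the kernel `T` on `(0, ∞)` are at most `1 + δ`. -/
def CrossRatioLE (T : ℝ → ℝ → ℝ≥0∞) (δ : ℝ≥0) : Prop :=
  ∀ x x' z z', 0 < x → 0 < x' → 0 < z → 0 < z' →
    T x z * T x' z' ≤ (1 + δ : ℝ≥0) * (T x z' * T x' z)

theorem CrossRatioLE.mono {T : ℝ → ℝ → ℝ≥0∞} {δ δ' : ℝ≥0} (h : CrossRatioLE T δ) (hδ : δ ≤ δ') :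
    CrossRatioLE T δ' := fun x x' z z' hx hx' hz hz' =>
  (h x x' z z' hx hx' hz hz').trans (by gcongr)

/-- A kernel comparable to a function of the first variable alone has bounded cross-ratios. -/
theorem crossRatioLE_of_bounds {T : ℝ → ℝ → ℝ≥0∞} {g : ℝ → ℝ≥0∞} {e : ℝ≥0∞} {q : ℝ≥0}
    (hq : 1 ≤ (1 + q : ℝ≥0) * (e * e)) (hl : ∀ x z, 0 < x → 0 < z → e * g x ≤ T x z)
    (hu : ∀ x z, 0 < x → 0 < z → T x z ≤ g x) : CrossRatioLE T q := by
  intro x x' z z' hx hx' hz hz'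
  calc T x z * T x' z' ≤ 1 * (g x * g x') := by
        rw [one_mul]; exact mul_le_mul' (hu x z hx hz) (hu x' z' hx' hz')
    _ ≤ ((1 + q : ℝ≥0) * (e * e)) * (g x * g x') := by gcongr
    _ = (1 + q : ℝ≥0) * ((e * g x) * (e * g x')) := by ring
    _ ≤ _ := by gcongr; exacts [hl x z' hx hz', hl x' z hx' hz]

section Composition

variable {μ : Measure ℝ} {A B : ℝ → ℝ → ℝ≥0∞} {m : ℝ → ℝ≥0∞}

/-- A product of two compositions is a double integral over `(y, y')`. Symmetrising in `y` and `y'`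
brings both sides of the cross-ratio inequality to a common form, so that integrands can be
compared. -/
theorem CrossRatioLE.comp_of_pointwise (hA : Measurable A.uncurry) (hB : Measurable B.uncurry)
    (hm : Measurable m) {κ : ℝ≥0}
    (h : ∀ x x' z z' y y', 0 < x → 0 < x' → 0 < z → 0 < z' → 0 < y → 0 < y' →
      A x y * A x' y' * (B y z * B y' z') + A x y' * A x' y * (B y' z * B y z')
        ≤ (1 + κ : ℝ≥0) * (A x y * A x' y' * (B y' z * B y z')
          + A x y' * A x' y * (B y z * B y' z')))
    (hm0 : ∀ y ≤ 0, m y = 0) :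
    CrossRatioLE (fun x z => ∫⁻ y, A x y * m y * B y z ∂μ) κ := by
  intro x x' z z' hx hx' hz hz'
  have hA' (x : ℝ) : Measurable (A x) := hA.comp measurable_prodMk_left
  have hB' (z : ℝ) : Measurable (fun y => B y z) := hB.comp measurable_prodMk_right
  have hmeas (x z : ℝ) : Measurable (fun y => A x y * m y * B y z) :=
    ((hA' x).mul hm).mul (hB' z)
  beta_reduce
  rw [← ENNReal.mul_le_mul_iff_right (a := 2) (by simp) (by simp),
    mul_left_comm 2 ((1 + κ : ℝ≥0) : ℝ≥0∞),
    lintegral_mul_lintegral_symm (hmeas _ _) (hmeas _ _),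
    lintegral_mul_lintegral_symm (hmeas _ _) (hmeas _ _),
    ← lintegral_const_mul' _ _ ENNReal.coe_ne_top]
  refine lintegral_mono fun y => ?_
  simp only
  rw [← lintegral_const_mul' _ _ ENNReal.coe_ne_top]
  refine lintegral_mono fun y' => ?_
  rcases le_or_gt y 0 with hy | hy
  · simp [hm0 y hy]
  rcases le_or_gt y' 0 with hy' | hy'
  · simp [hm0 y' hy']
  calc _ = (m y * m y') * (A x y * A x' y' * (B y z * B y' z')
            + A x y' * A x' y * (B y' z * B y z')) := by ring
    _ ≤ (m y * m y') * ((1 + κ : ℝ≥0) * (A x y * A x' y' * (B y' z * B y z')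
          + A x y' * A x' y * (B y z * B y' z'))) := by
        gcongr; exact h x x' z z' y y' hx hx' hz hz' hy hy'
    _ = _ := by ring

/-- No bound on `B` is needed: exchanging `y` and `y'` in the `A`-factors matches the two
symmetrised terms one by one. This allows an extension by a bare bond, which does not contract. -/
theorem CrossRatioLE.comp (hA : Measurable A.uncurry) (hB : Measurable B.uncurry)
    (hm : Measurable m) (hm0 : ∀ y ≤ 0, m y = 0) {δ : ℝ≥0} (h : CrossRatioLE A δ) :
    CrossRatioLE (fun x z => ∫⁻ y, A x y * m y * B y z ∂μ) δ := by
  refine .comp_of_pointwise hA hB hm (fun x x' z z' y y' hx hx' _ _ hy hy' => ?_) hm0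
  calc _ ≤ ((1 + δ : ℝ≥0) * (A x y' * A x' y)) * (B y z * B y' z')
          + ((1 + δ : ℝ≥0) * (A x y * A x' y')) * (B y' z * B y z') := by
        exact add_le_add (mul_le_mul_left (h x x' y y' hx hx' hy hy') _)
          (mul_le_mul_left (h x x' y' y hx hx' hy' hy) _)
    _ = _ := by ring

/-- The pairs `a, b` of `A`-products and `s, s'` of `B`-products are each comparable in both
directions, so `mul_add_mul_le_contraction` applies at every `(y, y')`. -/
theorem CrossRatioLE.comp_contraction (hA : Measurable A.uncurry) (hB : Measurable B.uncurry)
    (hm : Measurable m) (hm0 : ∀ y ≤ 0, m y = 0) (hAt : ∀ x y, A x y ≠ ∞) (hBt : ∀ x y, B x y ≠ ∞)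
    {δ q : ℝ≥0} (h : CrossRatioLE A δ) (h' : CrossRatioLE B q) :
    CrossRatioLE (fun x z => ∫⁻ y, A x y * m y * B y z ∂μ) (δ * (q / (2 + q))) := by
  refine .comp_of_pointwise hA hB hm (fun x x' z z' y y' hx hx' hz hz' hy hy' => ?_) hm0
  have h1 := h x x' y y' hx hx' hy hy'
  have h2 := h x x' y' y hx hx' hy' hy
  have h3 := h' y y' z z' hy hy' hz hz'
  have h4 := h' y' y z z' hy' hy hz hz'
  rw [mul_comm (B y z') (B y' z)] at h3
  rw [mul_comm (B y' z') (B y z)] at h4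
  generalize ha : A x y * A x' y' = a at *
  generalize hb : A x y' * A x' y = b at *
  generalize hs : B y z * B y' z' = s at *
  generalize hs' : B y' z * B y z' = s' at *
  lift a to ℝ≥0 using ha ▸ ENNReal.mul_ne_top (hAt _ _) (hAt _ _)
  lift b to ℝ≥0 using hb ▸ ENNReal.mul_ne_top (hAt _ _) (hAt _ _)
  lift s to ℝ≥0 using hs ▸ ENNReal.mul_ne_top (hBt _ _) (hBt _ _)
  lift s' to ℝ≥0 using hs' ▸ ENNReal.mul_ne_top (hBt _ _) (hBt _ _)
  exact_mod_cast mul_add_mul_le_contraction (by exact_mod_cast h1) (by exact_mod_cast h2)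
    (by exact_mod_cast h3) (by exact_mod_cast h4)

end Composition

/-! ### The transfer kernels of the chain -/

/-- Lebesgue measure on the unit interval. -/
def unitMeasure : Measure ℝ := volume.restrict (Icc 0 1)

instance : IsProbabilityMeasure unitMeasure := ⟨by simp [unitMeasure]⟩

/-- The function `exp (-c / x)` on `(0, ∞)`, extended by zero. -/
def barrier (c x : ℝ) : ℝ≥0∞ := if 0 < x then ENNReal.ofReal (Real.exp (-(c / x))) else 0

theorem barrier_of_pos {c x : ℝ} (hx : 0 < x) :
    barrier c x = ENNReal.ofReal (Real.exp (-(c / x))) := if_pos hx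

theorem barrier_of_nonpos {c x : ℝ} (hx : x ≤ 0) : barrier c x = 0 := if_neg hx.not_gt

theorem barrier_ne_zero {c x : ℝ} (hx : 0 < x) : barrier c x ≠ 0 := by
  simp [barrier_of_pos hx, Real.exp_pos]

theorem barrier_mono {c : ℝ} (hc : 0 ≤ c) : Monotone (barrier c) := by
  intro x y hxy
  rcases le_or_gt x 0 with hx | hx
  · simp [barrier_of_nonpos hx]
  · rw [barrier_of_pos hx, barrier_of_pos (hx.trans_le hxy)]
    gcongr

theorem barrier_le_one {c : ℝ} (hc : 0 ≤ c) (x : ℝ) : barrier c x ≤ 1 := by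
  rcases le_or_gt x 0 with hx | hx
  · simp [barrier_of_nonpos hx]
  · rw [barrier_of_pos hx, ENNReal.ofReal_le_one, Real.exp_le_one_iff, neg_nonpos]
    positivity

@[fun_prop]
theorem measurable_barrier (c : ℝ) : Measurable (barrier c) :=
  Measurable.ite measurableSet_Ioi (by fun_prop) measurable_const

/-- The interaction `exp (-γ / (x + z))` of two neighbours in `(0, ∞)`, extended by zero. -/
def bond (γ x z : ℝ) : ℝ≥0∞ := if 0 < x ∧ 0 < z then barrier γ (x + z) else 0

theorem bond_of_pos {γ x z : ℝ} (hx : 0 < x) (hz : 0 < z) : bond γ x z = barrier γ (x + z) :=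
  if_pos ⟨hx, hz⟩

theorem bond_mono {γ x x' z z' : ℝ} (hγ : 0 ≤ γ) (hx : x ≤ x') (hz : z ≤ z') :
    bond γ x z ≤ bond γ x' z' := by
  by_cases h : 0 < x ∧ 0 < z
  · rw [bond_of_pos h.1 h.2, bond_of_pos (h.1.trans_le hx) (h.2.trans_le hz)]
    exact barrier_mono hγ (add_le_add hx hz)
  · simp [bond, h]

theorem bond_le_one {γ : ℝ} (hγ : 0 ≤ γ) (x z : ℝ) : bond γ x z ≤ 1 := by
  unfold bond
  split_ifs
  exacts [barrier_le_one hγ _, zero_le_one]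

theorem barrier_le_bond_left {γ x z : ℝ} (hγ : 0 ≤ γ) (hz : 0 < z) :
    barrier γ x ≤ bond γ x z := by
  rcases le_or_gt x 0 with hx | hx
  · simp [barrier_of_nonpos hx]
  · rw [bond_of_pos hx hz]
    exact barrier_mono hγ (by linarith)

theorem barrier_le_bond_right {γ x z : ℝ} (hγ : 0 ≤ γ) (hx : 0 < x) :
    barrier γ z ≤ bond γ x z := by
  rcases le_or_gt z 0 with hz | hz
  · simp [barrier_of_nonpos hz]
  · rw [bond_of_pos hx hz]
    exact barrier_mono hγ (by linarith)

theorem measurable_bond (γ : ℝ) : Measurable (bond γ).uncurry :=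
  Measurable.ite ((measurableSet_lt measurable_const measurable_fst).inter
    (measurableSet_lt measurable_const measurable_snd)) (by fun_prop) measurable_const

/-- The weight of a chain with free ends `x` and `z`, the `n` sites between them being integrated
out. -/
def bridge (β γ : ℝ) : ℕ → ℝ → ℝ → ℝ≥0∞
  | 0 => bond γ
  | n + 1 => fun x z => ∫⁻ y, bridge β γ n x y * barrier (β / 2) y * bond γ y z ∂unitMeasure

theorem measurable_bridge (β γ : ℝ) (n : ℕ) : Measurable (bridge β γ n).uncurry := by
  induction n with
  | zero => exact measurable_bond γ
  | succ n ih =>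
    refine Measurable.lintegral_prod_right
      (f := fun (p : ℝ × ℝ) y => bridge β γ n p.1 y * barrier (β / 2) y * bond γ y p.2) ?_
    have h1 : Measurable fun q : (ℝ × ℝ) × ℝ => bridge β γ n q.1.1 q.2 :=
      ih.comp (by fun_prop : Measurable fun q : (ℝ × ℝ) × ℝ => (q.1.1, q.2))
    have h2 : Measurable fun q : (ℝ × ℝ) × ℝ => bond γ q.2 q.1.2 :=
      (measurable_bond γ).comp (by fun_prop : Measurable fun q : (ℝ × ℝ) × ℝ => (q.2, q.1.2))
    exact (h1.mul (by fun_prop)).mul h2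

variable {β γ : ℝ}

theorem bridge_le_one (hβ : 0 ≤ β) (hγ : 0 ≤ γ) (n : ℕ) (x z : ℝ) : bridge β γ n x z ≤ 1 := by
  induction n generalizing x z with
  | zero => exact bond_le_one hγ x z
  | succ n ih =>
    calc bridge β γ (n + 1) x z ≤ ∫⁻ _, 1 * 1 * 1 ∂unitMeasure :=
          lintegral_mono fun y => mul_le_mul' (mul_le_mul' (ih x y)
            (barrier_le_one (by positivity) y)) (bond_le_one hγ y z)
      _ = 1 := by simp

/-- The recursion appends single bonds; this regroups the last two sites so that a one-site bridge,
the contracting kernel, becomes the right factor. -/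
theorem bridge_add_two (n : ℕ) (x z : ℝ) :
    bridge β γ (n + 2) x z
      = ∫⁻ y, bridge β γ n x y * barrier (β / 2) y * bridge β γ 1 y z ∂unitMeasure := by
  have hT (x : ℝ) : Measurable (bridge β γ n x) :=
    (measurable_bridge β γ n).comp measurable_prodMk_left
  have hb (z : ℝ) : Measurable fun y => bond γ y z :=
    (measurable_bond γ).comp measurable_prodMk_right
  have hb' (y : ℝ) : Measurable (bond γ y) := (measurable_bond γ).comp measurable_prodMk_left
  calc bridge β γ (n + 2) x z
      = ∫⁻ u, ∫⁻ y, bridge β γ n x y * barrier (β / 2) y * bond γ y u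
          * (barrier (β / 2) u * bond γ u z) ∂unitMeasure ∂unitMeasure := by
        change ∫⁻ u, (∫⁻ y, _ ∂unitMeasure) * barrier (β / 2) u * bond γ u z ∂unitMeasure = _
        refine lintegral_congr fun u => ?_
        have hm : Measurable fun y => bridge β γ n x y * barrier (β / 2) y * bond γ y u :=
          ((hT x).mul (by fun_prop)).mul (hb u)
        rw [lintegral_mul_const _ hm, mul_assoc]
    _ = ∫⁻ y, ∫⁻ u, bridge β γ n x y * barrier (β / 2) y * bond γ y u
          * (barrier (β / 2) u * bond γ u z) ∂unitMeasure ∂unitMeasure := by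
        refine lintegral_lintegral_swap (Measurable.aemeasurable ?_)
        refine ((Measurable.mul (((hT x).comp measurable_snd).mul (by fun_prop)) ?_)).mul
          (((measurable_barrier _).comp measurable_fst).mul ((hb z).comp measurable_fst))
        exact (measurable_bond γ).comp measurable_swap
    _ = _ := by
        refine lintegral_congr fun y => ?_
        simp_rw [mul_assoc (bridge β γ n x y * barrier (β / 2) y)]
        have hm : Measurable fun u => bond γ y u * (barrier (β / 2) u * bond γ u z) :=
          (hb' y).mul ((measurable_barrier _).mul (hb z))
        rw [lintegral_const_mul _ hm]
        simp_rw [← mul_assoc (bond γ y _)]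
        rfl

/-- The integral of `exp (-2γ / y)` over the unit interval. -/
def minorization (γ : ℝ) : ℝ≥0∞ := ∫⁻ y, barrier γ y * barrier γ y ∂unitMeasure

theorem minorization_le_lintegral (hγ : 0 ≤ γ) :
    minorization γ ≤ ∫⁻ y, barrier γ y ∂unitMeasure :=
  lintegral_mono fun y => mul_le_of_le_one_right' (barrier_le_one hγ y)

theorem minorization_le_one (hγ : 0 ≤ γ) : minorization γ ≤ 1 :=
  (minorization_le_lintegral hγ).trans <|
    (lintegral_mono fun y => barrier_le_one hγ y).trans (by simp)

theorem bridge_one_le (hγ : 0 ≤ γ) (x z : ℝ) :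
    bridge β γ 1 x z ≤ ∫⁻ y, barrier (β / 2) y ∂unitMeasure :=
  lintegral_mono fun y => (mul_le_of_le_one_right' (bond_le_one hγ y z)).trans
    (mul_le_of_le_one_left' (bond_le_one hγ x y))

/-- Each bond is at least `barrier γ y` wherever its other end lies. Then `barrier γ y * barrier γ
y` and `barrier (β / 2) y` both increase in `y`, and Chebyshev's inequality splits their integral,
leaving a ratio to the upper bound that is free of `β`. -/
theorem le_bridge_one (hβ : 0 ≤ β) (hγ : 0 ≤ γ) {x z : ℝ} (hx : 0 < x) (hz : 0 < z) :
    minorization γ * ∫⁻ y, barrier (β / 2) y ∂unitMeasure ≤ bridge β γ 1 x z := by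
  have hm : Monotone fun y => barrier γ y * barrier γ y := fun a b h =>
    mul_le_mul' (barrier_mono hγ h) (barrier_mono hγ h)
  refine (lintegral_mul_lintegral_le_of_monotone hm (barrier_mono (by positivity))).trans ?_
  refine lintegral_mono fun y => ?_
  calc barrier γ y * barrier γ y * barrier (β / 2) y
      = barrier γ y * barrier (β / 2) y * barrier γ y := by ring
    _ ≤ _ := by
      gcongr
      exacts [barrier_le_bond_right hγ hx, barrier_le_bond_left hγ hz]

variable {q : ℝ≥0}

theorem crossRatioLE_bridge_one (hβ : 0 ≤ β) (hγ : 0 ≤ γ)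
    (hq : 1 ≤ (1 + q : ℝ≥0) * (minorization γ * minorization γ)) :
    CrossRatioLE (bridge β γ 1) q :=
  crossRatioLE_of_bounds (g := fun _ => ∫⁻ y, barrier (β / 2) y ∂unitMeasure) hq
    (fun _ _ hx hz => le_bridge_one hβ hγ hx hz) (fun x z _ _ => bridge_one_le hγ x z)

theorem CrossRatioLE.bridge_succ {n : ℕ} {δ : ℝ≥0} (h : CrossRatioLE (bridge β γ n) δ) :
    CrossRatioLE (bridge β γ (n + 1)) δ :=
  h.comp (measurable_bridge β γ n) (measurable_bond γ) (measurable_barrier _)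
    (fun _ hy => barrier_of_nonpos hy)

/-- The cross-ratios of the bridges tend to one exponentially fast. -/
theorem crossRatioLE_bridge (hβ : 0 ≤ β) (hγ : 0 ≤ γ)
    (hq : 1 ≤ (1 + q : ℝ≥0) * (minorization γ * minorization γ)) (n : ℕ) :
    CrossRatioLE (bridge β γ (n + 1)) (q * (q / (2 + q)) ^ (n / 2)) := by
  have hT (n : ℕ) (x y : ℝ) : bridge β γ n x y ≠ ∞ :=
    ((bridge_le_one hβ hγ n x y).trans_lt ENNReal.one_lt_top).ne
  have h1 := crossRatioLE_bridge_one (β := β) hβ hγ hq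
  -- Each contraction adds two sites, the junction and the interior of a one-site bridge. An even
  -- number of sites is reached by one further bond.
  have odd (m : ℕ) : CrossRatioLE (bridge β γ (2 * m + 1)) (q * (q / (2 + q)) ^ m) := by
    induction m with
    | zero => simpa using h1
    | succ m ih =>
      have := ih.comp_contraction (measurable_bridge β γ _) (measurable_bridge β γ 1)
        (measurable_barrier (β / 2)) (fun _ hy => barrier_of_nonpos hy) (hT _) (hT 1) h1
        (μ := unitMeasure)
      rw [pow_succ, ← mul_assoc]
      convert this using 3
      exact bridge_add_two _ _ _
  rcases Nat.even_or_odd' n with ⟨m, rfl | rfl⟩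
  · simpa using odd m
  · have : (2 * m + 1) / 2 = m := by omega
    rw [this]
    exact (odd m).bridge_succ

theorem bridge_of_nonpos (n : ℕ) {x z : ℝ} (h : x ≤ 0 ∨ z ≤ 0) : bridge β γ n x z = 0 := by
  have h0 {x z : ℝ} (h : x ≤ 0 ∨ z ≤ 0) : bond γ x z = 0 := if_neg fun h' => by
    rcases h with h | h
    exacts [h'.1.not_ge h, h'.2.not_ge h]
  induction n generalizing x z with
  | zero => exact h0 h
  | succ n ih =>
    rcases h with h | h
    · simp [bridge, ih (.inl h)]
    · simp [bridge, h0 (.inr h)]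

/-- The cross-ratio bound for `bridge` holds at all real arguments, since both sides vanish outside
the positive quadrant. -/
theorem CrossRatioLE.bridge_mul_bridge_le {n : ℕ} {δ : ℝ≥0} (h : CrossRatioLE (bridge β γ n) δ)
    (x x' z z' : ℝ) : bridge β γ n x z * bridge β γ n x' z'
      ≤ (1 + δ : ℝ≥0) * (bridge β γ n x z' * bridge β γ n x' z) := by
  rcases le_or_gt x 0 with hx | hx
  · simp [bridge_of_nonpos n (.inl hx : x ≤ 0 ∨ z ≤ 0)]
  rcases le_or_gt z 0 with hz | hz
  · simp [bridge_of_nonpos n (.inr hz : x ≤ 0 ∨ z ≤ 0)]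
  rcases le_or_gt x' 0 with hx' | hx'
  · simp [bridge_of_nonpos n (.inl hx' : x' ≤ 0 ∨ z' ≤ 0)]
  rcases le_or_gt z' 0 with hz' | hz'
  · simp [bridge_of_nonpos n (.inr hz' : x' ≤ 0 ∨ z' ≤ 0)]
  exact h x x' z z' hx hx' hz hz'

/-- A bound on the cross-ratios that includes the case of adjacent sites. -/
theorem bridge_mul_bridge_mul_barrier_le (hβ : 0 ≤ β) (hγ : 0 ≤ γ)
    (hq : 1 ≤ (1 + q : ℝ≥0) * (minorization γ * minorization γ)) (n : ℕ) (x x' z z' : ℝ) :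
    bridge β γ n x z * bridge β γ n x' z' * (barrier γ x' * barrier γ z')
      ≤ (1 + q : ℝ≥0) * (bridge β γ n x z' * bridge β γ n x' z) := by
  cases n with
  | zero =>
    rcases le_or_gt x 0 with hx | hx
    · simp [bridge_of_nonpos 0 (.inl hx : x ≤ 0 ∨ z ≤ 0)]
    rcases le_or_gt z 0 with hz | hz
    · simp [bridge_of_nonpos 0 (.inr hz : x ≤ 0 ∨ z ≤ 0)]
    -- The unswapped bonds are at most `1`, and the two barriers are dominated by the swapped bonds.
    calc bridge β γ 0 x z * bridge β γ 0 x' z' * (barrier γ x' * barrier γ z')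
        ≤ 1 * 1 * (bond γ x' z * bond γ x z') := by
          gcongr
          exacts [bond_le_one hγ _ _, bond_le_one hγ _ _, barrier_le_bond_left hγ hz,
            barrier_le_bond_right hγ hx]
      _ = 1 * (bridge β γ 0 x z' * bridge β γ 0 x' z) := by simp [bridge, mul_comm]
      _ ≤ _ := by gcongr; exact_mod_cast le_self_add
  | succ n =>
    refine (mul_le_of_le_one_right' (mul_le_one' (barrier_le_one hγ _)
      (barrier_le_one hγ _))).trans ?_
    refine ((crossRatioLE_bridge hβ hγ hq n).mono ?_).bridge_mul_bridge_le x x' z z'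
    refine mul_le_of_le_one_right' (pow_le_one' (div_le_one_of_le₀ ?_ (by positivity)) _)
    exact le_add_self

/-! ### Marginals -/

section Marginal

variable {ι : Type*} [DecidableEq ι] {μ : ι → Measure ℝ}

theorem lmarginal_mul_of_dependsOn {s : Finset ι} {f g : (ι → ℝ) → ℝ≥0∞} (hf : Measurable f)
    (hg : DependsOn g ((s : Set ι)ᶜ)) (y : ι → ℝ) :
    (∫⋯∫⁻_s, (fun y => f y * g y) ∂μ) y = (∫⋯∫⁻_s, f ∂μ) y * g y := by
  have (u : s → ℝ) : g (Function.updateFinset y s u) = g y :=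
    hg fun i hi => by simp [Function.updateFinset, show i ∉ s by simpa using hi]
  have hm : Measurable fun u => f (Function.updateFinset y s u) := hf.comp measurable_updateFinset
  simp_rw [lmarginal, this]
  rw [lintegral_mul_const _ hm]

variable {I J : Finset ι} {H P : (ι → ℝ) → ℝ≥0∞}

theorem lmarginal_mul_lmarginal (hH : Measurable H) (I J : Finset ι) (y : ι → ℝ) :
    (∫⋯∫⁻_J, H ∂μ) y * (∫⋯∫⁻_I, H ∂μ) y
      = ∫⁻ v, ∫⁻ u, H (Function.updateFinset y J u) * H (Function.updateFinset y I v)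
          ∂Measure.pi (fun i : J => μ i) ∂Measure.pi (fun i : I => μ i) := by
  have hI : Measurable fun v => H (Function.updateFinset y I v) := hH.comp measurable_updateFinset
  have hJ : Measurable fun u => H (Function.updateFinset y J u) := hH.comp measurable_updateFinset
  simp_rw [lintegral_mul_const _ hJ]
  rw [lintegral_const_mul _ hI]
  rfl

variable [∀ i, SigmaFinite (μ i)]

theorem lmarginal_union_mul_const (hP : Measurable P) (hIJ : Disjoint I J) {c : ℝ≥0∞} (hc : c ≠ ∞)
    (y : ι → ℝ) :
    (∫⋯∫⁻_I ∪ J, P ∂μ) y * c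
      = ∫⁻ v, ∫⁻ u, P (Function.updateFinset (Function.updateFinset y I v) J u) * c
          ∂Measure.pi (fun i : J => μ i) ∂Measure.pi (fun i : I => μ i) := by
  simp_rw [lintegral_mul_const' _ _ hc]
  rw [lmarginal_union μ P hP hIJ]
  rfl

/-- In the applications `H` is the joint weight, `c = H y`, and `P` is `H`, possibly with an extra
weight. Both sides become integrals over the same resampled values `(v, u)`, which leaves a
pointwise comparison. -/
theorem lmarginal_union_mul_le (hH : Measurable H) (hP : Measurable P) (hIJ : Disjoint I J)
    {c : ℝ≥0∞} (hc : c ≠ ∞) {K : ℝ≥0} {y : ι → ℝ}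
    (h : ∀ v u, P (Function.updateFinset (Function.updateFinset y I v) J u) * c
      ≤ K * (H (Function.updateFinset y J u) * H (Function.updateFinset y I v))) :
    (∫⋯∫⁻_I ∪ J, P ∂μ) y * c ≤ K * ((∫⋯∫⁻_J, H ∂μ) y * (∫⋯∫⁻_I, H ∂μ) y) := by
  rw [lmarginal_union_mul_const hP hIJ hc, lmarginal_mul_lmarginal hH,
    ← lintegral_const_mul' _ _ ENNReal.coe_ne_top]
  simp_rw [← lintegral_const_mul' _ _ (ENNReal.coe_ne_top (r := K))]
  exact lintegral_mono fun v => lintegral_mono fun u => h v u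

theorem le_lmarginal_union_mul (hH : Measurable H) (hP : Measurable P) (hIJ : Disjoint I J)
    {c : ℝ≥0∞} (hc : c ≠ ∞) {K : ℝ≥0} {y : ι → ℝ}
    (h : ∀ v u, H (Function.updateFinset y J u) * H (Function.updateFinset y I v)
      ≤ K * (P (Function.updateFinset (Function.updateFinset y I v) J u) * c)) :
    (∫⋯∫⁻_J, H ∂μ) y * (∫⋯∫⁻_I, H ∂μ) y ≤ K * ((∫⋯∫⁻_I ∪ J, P ∂μ) y * c) := by
  rw [lmarginal_union_mul_const hP hIJ hc, lmarginal_mul_lmarginal hH,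
    ← lintegral_const_mul' _ _ ENNReal.coe_ne_top]
  simp_rw [← lintegral_const_mul' _ _ (ENNReal.coe_ne_top (r := K))]
  exact lintegral_mono fun v => lintegral_mono fun u => h v u

/-- Chebyshev's inequality in one coordinate. -/
theorem lintegral_mul_lmarginal_le [∀ i, IsProbabilityMeasure (μ i)] {s : Finset ι} {i : ι}
    (hi : i ∈ s) {g : ℝ → ℝ≥0∞} (hg : Monotone g) (hP : Monotone P) (hPm : Measurable P)
    (y : ι → ℝ) :
    (∫⁻ x, g x ∂μ i) * (∫⋯∫⁻_s, P ∂μ) y ≤ (∫⋯∫⁻_s, (fun y => P y * g (y i)) ∂μ) y := by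
  have hgm := hg.measurable
  rw [lmarginal_erase' (fun y => P y * g (y i)) (by fun_prop) hi, lmarginal_erase' P hPm hi]
  refine (lintegral_const_mul_le _ _).trans ?_
  refine lmarginal_mono (f := fun y => (∫⁻ x, g x ∂μ i) * ∫⁻ x, P (Function.update y i x) ∂μ i)
    (fun y => ?_) y
  beta_reduce
  rw [mul_comm]
  simp only [Function.update_self]
  exact lintegral_mul_lintegral_le_of_monotone
    (fun a b h => hP (update_le_update_iff.2 ⟨h, fun _ _ => le_rfl⟩)) hg

end Marginal

/-! ### Segments and gaps of the chain -/

/-- The weight of the sites `0, …, p` of a configuration and of the bonds between them. -/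
def segmentWeight (β γ : ℝ) (s : ℕ → ℝ) (p : ℕ) : ℝ≥0∞ :=
  barrier (β / 2) (s 0)
    * ∏ k ∈ Finset.range p, (bond γ (s k) (s (k + 1)) * barrier (β / 2) (s (k + 1)))

/-- The weight of the sites strictly between `0` and `r + 1` and of the bonds adjacent to them. -/
def gapWeight (β γ : ℝ) (s : ℕ → ℝ) (r : ℕ) : ℝ≥0∞ :=
  bond γ (s 0) (s 1)
    * ∏ k ∈ Finset.range r, (barrier (β / 2) (s (k + 1)) * bond γ (s (k + 1)) (s (k + 2)))

variable {β γ : ℝ}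

theorem segmentWeight_congr {s s' : ℕ → ℝ} {p : ℕ} (h : ∀ k ≤ p, s k = s' k) :
    segmentWeight β γ s p = segmentWeight β γ s' p := by
  unfold segmentWeight
  rw [h 0 (by simp)]
  congr 1
  refine Finset.prod_congr rfl fun k hk => ?_
  rw [Finset.mem_range] at hk
  rw [h k (by omega), h (k + 1) (by omega)]

theorem gapWeight_congr {s s' : ℕ → ℝ} {r : ℕ} (h : ∀ k ≤ r + 1, s k = s' k) :
    gapWeight β γ s r = gapWeight β γ s' r := by
  unfold gapWeight
  rw [h 0 (by simp), h 1 (by simp)]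
  congr 1
  refine Finset.prod_congr rfl fun k hk => ?_
  rw [Finset.mem_range] at hk
  rw [h (k + 1) (by omega), h (k + 2) (by omega)]

theorem measurable_bond_comp {α : Type*} [MeasurableSpace α] {f g : α → ℝ} (hf : Measurable f)
    (hg : Measurable g) : Measurable fun a => bond γ (f a) (g a) :=
  (measurable_bond γ).comp (hf.prodMk hg)

theorem measurable_gapWeight {ι : Type*} (v : ℕ → ι) (r : ℕ) :
    Measurable fun y : ι → ℝ => gapWeight β γ (fun k => y (v k)) r :=
  (measurable_bond_comp (by fun_prop) (by fun_prop)).mul <| Finset.measurable_prod _ fun _ _ =>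
    Measurable.mul (by fun_prop) (measurable_bond_comp (by fun_prop) (by fun_prop))

/-- Splitting a product along the circle into a segment and a gap. -/
theorem prod_range_add_one_add (s : ℕ → ℝ) (p r : ℕ) :
    ∏ k ∈ Finset.range (p + 1 + r), (barrier (β / 2) (s k) * bond γ (s k) (s (k + 1)))
      = segmentWeight β γ s p * gapWeight β γ (fun k => s (p + k)) r := by
  have h (p : ℕ) :
      ∏ k ∈ Finset.range (p + 1), (barrier (β / 2) (s k) * bond γ (s k) (s (k + 1)))
        = segmentWeight β γ s p * bond γ (s p) (s (p + 1)) := by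
    induction p with
    | zero => simp [segmentWeight]
    | succ p ih =>
      rw [Finset.prod_range_succ, ih, segmentWeight, segmentWeight, Finset.prod_range_succ]
      ring
  rw [Finset.prod_range_add, h, gapWeight, mul_assoc]
  simp only [add_assoc, add_comm 1, add_zero]

/-- Integrating out the sites of a gap. -/
theorem lmarginal_gapWeight {ι : Type*} [DecidableEq ι] (v : ℕ → ι) (n : ℕ)
    (hv : InjOn v (Iio (n + 2))) (y : ι → ℝ) :
    (∫⋯∫⁻_(Finset.range n).image (fun k => v (k + 1)),
      (fun y => gapWeight β γ (fun k => y (v k)) n) ∂fun _ => unitMeasure) y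
      = bridge β γ n (y (v 0)) (y (v (n + 1))) := by
  induction n generalizing y with
  | zero => simp [gapWeight, bridge]
  | succ n ih =>
    have hne {j k : ℕ} (hj : j < n + 3) (hk : k < n + 3) (hjk : j ≠ k) : v j ≠ v k :=
      fun h => hjk (hv hj hk h)
    have hnot {j : ℕ} (hj : n < j) (hj' : j < n + 3) :
        v j ∉ (Finset.range n).image (fun k => v (k + 1)) := by
      simp only [Finset.mem_image, Finset.mem_range, not_exists, not_and]
      exact fun k hk => hne (by omega) hj' (by omega)
    -- The last site is integrated outermost, matching the recursion for `bridge`. Its factor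
    -- involves none of the inner sites and leaves the inner integral.
    rw [Finset.range_add_one, Finset.image_insert,
      lmarginal_insert _ (measurable_gapWeight v (n + 1)) (hnot (by omega) (by omega))]
    refine lintegral_congr fun x => ?_
    have hsplit : (fun y : ι → ℝ => gapWeight β γ (fun k => y (v k)) (n + 1))
        = fun y => gapWeight β γ (fun k => y (v k)) n
          * (barrier (β / 2) (y (v (n + 1))) * bond γ (y (v (n + 1))) (y (v (n + 2)))) := by
      funext y
      rw [gapWeight, gapWeight, Finset.prod_range_succ, mul_assoc]
    rw [hsplit, lmarginal_mul_of_dependsOn (measurable_gapWeight v n),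
      ih (hv.mono (Iio_subset_Iio (by omega)))]
    · rw [Function.update_self, Function.update_of_ne (hne (by omega) (by omega) (by omega)),
        Function.update_of_ne (hne (by omega) (by omega) (by omega)), mul_assoc]
    · intro y y' h
      beta_reduce
      rw [h (v (n + 1)) (by simpa using hnot (j := n + 1) (by omega) (by omega)),
        h (v (n + 2)) (by simpa using hnot (j := n + 2) (by omega) (by omega))]

/-! ### Arcs of the circle -/

section Arc

theorem add_natCast_inj {N : ℕ} {a : ZMod N} {j k : ℕ} (hj : j < N) (hk : k < N)
    (h : a + (j : ZMod N) = a + k) : j = k := by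
  have := (ZMod.natCast_eq_natCast_iff' j k N).1 (add_left_cancel h)
  rwa [Nat.mod_eq_of_lt hj, Nat.mod_eq_of_lt hk] at this

variable {N : ℕ}

/-- The arc `{a + m, …, a + (m + r - 1)}`. -/
def arc (a : ZMod N) (m r : ℕ) : Finset (ZMod N) :=
  (Finset.range r).image fun k => a + ((m + k : ℕ) : ZMod N)

theorem add_natCast_mem_arc {a : ZMod N} {m r k : ℕ} (hmr : m + r ≤ N) (hk : k < N) :
    a + (k : ZMod N) ∈ arc a m r ↔ m ≤ k ∧ k < m + r := by
  simp only [arc, Finset.mem_image, Finset.mem_range]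
  constructor
  · rintro ⟨j, hj, h⟩
    have := add_natCast_inj (by omega) hk h
    omega
  · exact fun h => ⟨k - m, by omega, by rw [Nat.add_sub_cancel' h.1]⟩

variable [NeZero N]

theorem exists_eq_add_natCast (a i : ZMod N) : ∃ k < N, i = a + (k : ZMod N) :=
  ⟨(i - a).val, ZMod.val_lt _, by simp⟩

/-- Two non-empty disjoint blocks and the gaps between them divide the circle into four arcs. -/
theorem IsBlock.exists_arcs {I J : Finset (ZMod N)} (hI : IsBlock I) (hJ : IsBlock J)
    (hI0 : I.Nonempty) (hJ0 : J.Nonempty) (hIJ : Disjoint I J) :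
    ∃ (a : ZMod N) (p r q r' : ℕ), N = (p + 1 + r) + (q + 1 + r') ∧
      I = arc a 0 (p + 1) ∧ J = arc a (p + 1 + r) (q + 1) := by
  obtain ⟨a, n, rfl⟩ := hI
  obtain ⟨b, n', rfl⟩ := hJ
  obtain ⟨m, hm, rfl⟩ := exists_eq_add_natCast a b
  have hn : 0 < n := by simpa [Nat.pos_iff_ne_zero] using hI0
  have hn' : 0 < n' := by simpa [Nat.pos_iff_ne_zero] using hJ0
  have hdisj (i j : ℕ) (hi : i < n) (hj : j < n') : a + (i : ZMod N) ≠ a + m + j := fun h =>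
    Finset.disjoint_left.1 hIJ (Finset.mem_image_of_mem _ (Finset.mem_range.2 hi))
      (h ▸ Finset.mem_image_of_mem (fun k : ℕ => a + (m : ZMod N) + k) (Finset.mem_range.2 hj))
  have hmn : n ≤ m := by
    by_contra! h
    exact hdisj m 0 h hn' (by simp)
  -- Otherwise the second block would run round the circle to `a`, at its index `N - m`.
  have hmN : m + n' ≤ N := by
    by_contra! h
    refine hdisj 0 (N - m) hn (by omega) ?_
    rw [Nat.cast_sub hm.le]
    simp
  refine ⟨a, n - 1, m - n, n' - 1, N - m - n', by omega, ?_, ?_⟩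
  · rw [arc, Nat.sub_add_cancel hn]
    simp
  · rw [arc, Nat.sub_add_cancel hn', Nat.sub_add_cancel hn, Nat.add_sub_cancel' hmn]
    simp [add_assoc]

variable {a : ZMod N} {p r q r' : ℕ}

theorem disjoint_arc_arc {m n : ℕ} (hmr : m + r ≤ n) (hn : n + q ≤ N) :
    Disjoint (arc a m r) (arc a n q) := by
  refine Finset.disjoint_left.2 fun i hi hj => ?_
  obtain ⟨k, hk, rfl⟩ := exists_eq_add_natCast a i
  rw [add_natCast_mem_arc (by omega) hk] at hi hj
  omega

theorem compl_arc_union_arc (hN : N = (p + 1 + r) + (q + 1 + r')) :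
    (arc a 0 (p + 1) ∪ arc a (p + 1 + r) (q + 1))ᶜ
      = arc a (p + 1) r ∪ arc a (p + 1 + r + (q + 1)) r' := by
  ext i
  obtain ⟨k, hk, rfl⟩ := exists_eq_add_natCast a i
  rw [Finset.mem_compl, Finset.mem_union, Finset.mem_union, add_natCast_mem_arc (by omega) hk,
    add_natCast_mem_arc (by omega) hk, add_natCast_mem_arc (by omega) hk,
    add_natCast_mem_arc (by omega) hk]
  omega

/-- Only upper bounds on `separation` are needed: both gaps then have at least that many sites. -/
theorem separation_le_left (hN : N = (p + 1 + r) + (q + 1 + r')) :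
    separation (arc a 0 (p + 1)) (arc a (p + 1 + r) (q + 1)) ≤ r := by
  refine Nat.sInf_le ⟨a + (p : ℕ), ?_, a + (p + 1 + r : ℕ), ?_, .inl ?_⟩
  · exact (add_natCast_mem_arc (by omega) (by omega)).2 (by omega)
  · exact (add_natCast_mem_arc (by omega) (by omega)).2 (by omega)
  · push_cast; ring

theorem separation_le_right (hN : N = (p + 1 + r) + (q + 1 + r')) :
    separation (arc a 0 (p + 1)) (arc a (p + 1 + r) (q + 1)) ≤ r' := by
  refine Nat.sInf_le ⟨a + (0 : ℕ), ?_, a + (p + 1 + r + q : ℕ), ?_, .inr ?_⟩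
  · exact (add_natCast_mem_arc (by omega) (by omega)).2 (by omega)
  · exact (add_natCast_mem_arc (by omega) (by omega)).2 (by omega)
  · have : ((p + 1 + r + q : ℕ) : ZMod N) + ((r' + 1 : ℕ) : ZMod N) = 0 := by
      rw [← Nat.cast_add, show p + 1 + r + q + (r' + 1) = N by omega, ZMod.natCast_self]
    rw [add_assoc, this, Nat.cast_zero]

end Arc

/-! ### The weight of the closed chain -/

section Chain

variable {N : ℕ} {β γ : ℝ} {a : ZMod N} {p r q r' : ℕ}

theorem lmarginal_arc_gapWeight (m r : ℕ) (h : r + 2 ≤ N) (y : ZMod N → ℝ) :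
    (∫⋯∫⁻_arc a (m + 1) r, (fun y => gapWeight β γ (fun k => y (a + (m + k : ℕ))) r)
      ∂fun _ => unitMeasure) y
      = bridge β γ r (y (a + m)) (y (a + (m + 1 + r : ℕ))) := by
  have := lmarginal_gapWeight (β := β) (γ := γ) (fun k => a + ((m + k : ℕ) : ZMod N)) r ?_ y
  · simp only [add_zero, add_comm _ 1, add_left_comm _ 1, ← add_assoc] at this ⊢
    exact this
  · intro j hj k hk h
    refine add_natCast_inj (a := a + (m : ZMod N)) (hj.trans_le ‹_›) (hk.trans_le ‹_›) ?_
    simpa [add_assoc] using h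

variable [NeZero N]

/-- The Gibbs weight as a product over sites and bonds. -/
def chainWeight (β γ : ℝ) (y : ZMod N → ℝ) : ℝ≥0∞ :=
  ∏ i, (barrier (β / 2) (y i) * bond γ (y i) (y (i + 1)))

theorem ofReal_weight (y : ZMod N → ℝ) : ENNReal.ofReal (weight β γ y) = chainWeight β γ y := by
  by_cases h : ∀ i, 0 < y i
  · rw [weight, indicator_of_mem (by exact h), energy, ← Finset.sum_neg_distrib, Real.exp_sum,
      ENNReal.ofReal_prod_of_nonneg fun _ _ => (Real.exp_pos _).le]
    refine Finset.prod_congr rfl fun i _ => ?_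
    rw [bond_of_pos (h i) (h _), barrier_of_pos (h i), barrier_of_pos (add_pos (h i) (h _)),
      ← ENNReal.ofReal_mul (Real.exp_pos _).le, ← Real.exp_add, neg_add, div_div]
  · rw [weight, indicator_of_notMem (by exact h), ENNReal.ofReal_zero]
    obtain ⟨i, hi⟩ := not_forall.1 h
    exact (Finset.prod_eq_zero (Finset.mem_univ i)
      (by rw [barrier_of_nonpos (not_lt.1 hi), zero_mul])).symm

theorem measurable_chainWeight : Measurable (chainWeight β γ : (ZMod N → ℝ) → ℝ≥0∞) :=
  Finset.measurable_prod _ fun _ _ =>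
    Measurable.mul (by fun_prop) (measurable_bond_comp (by fun_prop) (by fun_prop))

/-- Monotonicity in every coordinate opens the chain to Chebyshev's inequality. -/
theorem chainWeight_mono (hβ : 0 ≤ β) (hγ : 0 ≤ γ) :
    Monotone (chainWeight β γ : (ZMod N → ℝ) → ℝ≥0∞) := fun _ _ h =>
  Finset.prod_le_prod' fun i _ =>
    mul_le_mul' (barrier_mono (by positivity) (h i)) (bond_mono hγ (h i) (h _))

theorem chainWeight_le_one (hβ : 0 ≤ β) (hγ : 0 ≤ γ) (y : ZMod N → ℝ) : chainWeight β γ y ≤ 1 :=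
  Finset.prod_le_one' fun _ _ => mul_le_one' (barrier_le_one (by positivity) _) (bond_le_one hγ _ _)

theorem chainWeight_ne_zero {y : ZMod N → ℝ} (h : ∀ i, 0 < y i) : chainWeight β γ y ≠ 0 :=
  Finset.prod_ne_zero_iff.2 fun i _ => mul_ne_zero (barrier_ne_zero (h i)) <| by
    rw [bond_of_pos (h i) (h _)]
    exact barrier_ne_zero (add_pos (h i) (h _))

theorem chainWeight_eq_mul (hN : N = (p + 1 + r) + (q + 1 + r')) (a : ZMod N) (y : ZMod N → ℝ) :
    chainWeight β γ y
      = segmentWeight β γ (fun k => y (a + (k : ℕ))) p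
        * gapWeight β γ (fun k => y (a + (p + k : ℕ))) r
        * (segmentWeight β γ (fun k => y (a + (p + 1 + r + k : ℕ))) q
          * gapWeight β γ (fun k => y (a + (p + 1 + r + (q + k) : ℕ))) r') := by
  have h : chainWeight β γ y = ∏ k ∈ Finset.range N,
      (barrier (β / 2) (y (a + (k : ℕ))) * bond γ (y (a + (k : ℕ))) (y (a + (k + 1 : ℕ)))) := by
    refine (Finset.prod_bij (fun (k : ℕ) _ => a + (k : ZMod N)) (fun _ _ => Finset.mem_univ _)
      (fun j hj k hk h => add_natCast_inj (Finset.mem_range.1 hj) (Finset.mem_range.1 hk) h)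
      (fun i _ => ?_) fun k _ => ?_).symm
    · obtain ⟨k, hk, rfl⟩ := exists_eq_add_natCast a i
      exact ⟨k, Finset.mem_range.2 hk, rfl⟩
    · rw [Nat.cast_add, Nat.cast_one, add_assoc]
  rw [h, show Finset.range N = Finset.range ((p + 1 + r) + (q + 1 + r')) by rw [← hN],
    Finset.prod_range_add, prod_range_add_one_add (fun k => y (a + (k : ℕ)))]
  congr 1
  exact prod_range_add_one_add (fun k => y (a + (p + 1 + r + k : ℕ))) q r'

/-- The weight of the two blocks, the gaps being integrated out. -/
theorem lmarginal_gaps_chainWeight (hN : N = (p + 1 + r) + (q + 1 + r')) (y : ZMod N → ℝ) :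
    (∫⋯∫⁻_(arc a 0 (p + 1) ∪ arc a (p + 1 + r) (q + 1))ᶜ, chainWeight β γ ∂fun _ => unitMeasure) y
      = segmentWeight β γ (fun k => y (a + (k : ℕ))) p
        * segmentWeight β γ (fun k => y (a + (p + 1 + r + k : ℕ))) q
        * (bridge β γ r (y (a + p)) (y (a + (p + 1 + r : ℕ)))
          * bridge β γ r' (y (a + (p + 1 + r + q : ℕ))) (y a)) := by
  have hmem {y y' : ZMod N → ℝ} {m n : ℕ} (hm : m + n ≤ N)
      (h : ∀ i ∈ ((arc a m n : Finset (ZMod N)) : Set (ZMod N))ᶜ, y i = y' i) {k : ℕ} (hk : k < N)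
      (hk' : k < m ∨ m + n ≤ k) : y (a + (k : ℕ)) = y' (a + (k : ℕ)) :=
    h _ (by rw [mem_compl_iff, Finset.mem_coe, add_natCast_mem_arc hm hk]; omega)
  have hfirst : ∫⋯∫⁻_arc a (p + 1 + r + (q + 1)) r', chainWeight β γ ∂(fun _ => unitMeasure)
      = fun y => gapWeight β γ (fun k => y (a + (p + k : ℕ))) r
        * (segmentWeight β γ (fun k => y (a + (k : ℕ))) p
        * segmentWeight β γ (fun k => y (a + (p + 1 + r + k : ℕ))) q
        * bridge β γ r' (y (a + (p + 1 + r + q : ℕ))) (y a)) := by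
    funext y
    have hF : (chainWeight β γ : (ZMod N → ℝ) → ℝ≥0∞) = fun y =>
        gapWeight β γ (fun k => y (a + (p + 1 + r + q + k : ℕ))) r'
        * (gapWeight β γ (fun k => y (a + (p + k : ℕ))) r
        * (segmentWeight β γ (fun k => y (a + (k : ℕ))) p
        * segmentWeight β γ (fun k => y (a + (p + 1 + r + k : ℕ))) q)) := by
      funext y
      rw [chainWeight_eq_mul hN a]
      simp only [← add_assoc]
      ring
    -- This gap closes the circle: its right end has index `N`, which is the site `a`.
    rw [hF, lmarginal_mul_of_dependsOn (measurable_gapWeight _ r'),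
      show p + 1 + r + (q + 1) = p + 1 + r + q + 1 by ring, lmarginal_arc_gapWeight _ _ (by omega),
      show p + 1 + r + q + 1 + r' = N by omega, ZMod.natCast_self, add_zero]
    · ring
    · intro y y' h
      beta_reduce
      have h' {k : ℕ} (hk : k < p + 1 + r + (q + 1)) := hmem (by omega) h (by omega) (.inl hk)
      rw [gapWeight_congr fun k hk => h' (k := p + k) (by omega),
        segmentWeight_congr fun k hk => h' (k := k) (by omega),
        segmentWeight_congr fun k hk => h' (k := p + 1 + r + k) (by omega)]
  rw [compl_arc_union_arc hN, lmarginal_union _ _ measurable_chainWeight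
    (disjoint_arc_arc (by omega) (by omega)), hfirst,
    lmarginal_mul_of_dependsOn (measurable_gapWeight _ r), lmarginal_arc_gapWeight _ _ (by omega)]
  · ring
  · intro y y' h
    beta_reduce
    have h' {k : ℕ} (hk : k < N) (hk' : k < p + 1 ∨ p + 1 + r ≤ k) := hmem (by omega) h hk hk'
    have h0 := h' (k := 0) (by omega) (by omega)
    rw [Nat.cast_zero, add_zero] at h0
    rw [segmentWeight_congr fun k hk => h' (k := k) (by omega) (by omega),
      segmentWeight_congr fun k hk => h' (k := p + 1 + r + k) (by omega) (by omega),
      h' (k := p + 1 + r + q) (by omega) (by omega), h0]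

end Chain

/-! ### Comparison of joint and product marginals -/

section Comparison

/-- The two mixed configurations arise from `y` and the resampled one by exchanging their values on
`J`. -/
theorem updateFinset_swap {ι : Type*} [DecidableEq ι] {I J : Finset ι} (hIJ : Disjoint I J)
    (y : ι → ℝ)
    (v : I → ℝ) (u : J → ℝ) :
    (∀ i ∈ I, Function.updateFinset y J u i = y i ∧ Function.updateFinset y I v i
      = Function.updateFinset (Function.updateFinset y I v) J u i) ∧
    (∀ j ∈ J, Function.updateFinset y J u j
      = Function.updateFinset (Function.updateFinset y I v) J u j
      ∧ Function.updateFinset y I v j = y j) := by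
  have h := Finset.disjoint_left.1 hIJ
  have h' := Finset.disjoint_right.1 hIJ
  refine ⟨fun i hi => ?_, fun j hj => ?_⟩
  · simp [Function.updateFinset, hi, h hi]
  · simp [Function.updateFinset, hj, h' hj]

variable {N : ℕ} [NeZero N] {β γ : ℝ} {a : ZMod N} {p r q r' : ℕ}

/-- Integral of the Gibbs weight over the coordinates outside `S`. -/
def unnormalizedMarginal (β γ : ℝ) (S : Finset (ZMod N)) : (ZMod N → ℝ) → ℝ≥0∞ :=
  ∫⋯∫⁻_Sᶜ, chainWeight β γ ∂fun _ => unitMeasure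

theorem measurable_unnormalizedMarginal (S : Finset (ZMod N)) :
    Measurable (unnormalizedMarginal β γ S) :=
  measurable_chainWeight.lmarginal _

theorem unnormalizedMarginal_le_one (hβ : 0 ≤ β) (hγ : 0 ≤ γ) (S : Finset (ZMod N))
    (y : ZMod N → ℝ) : unnormalizedMarginal β γ S y ≤ 1 :=
  (lintegral_mono fun _ => chainWeight_le_one hβ hγ _).trans (by simp)

theorem unnormalizedMarginal_ne_top (hβ : 0 ≤ β) (hγ : 0 ≤ γ) (S : Finset (ZMod N))
    (y : ZMod N → ℝ) : unnormalizedMarginal β γ S y ≠ ∞ :=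
  ((unnormalizedMarginal_le_one hβ hγ S y).trans_lt ENNReal.one_lt_top).ne

theorem ae_unitMeasure_pos : ∀ᵐ x ∂unitMeasure, 0 < x := by
  rw [unitMeasure, ← Measure.restrict_congr_set Ioc_ae_eq_Icc]
  exact (ae_restrict_mem measurableSet_Ioc).mono fun x hx => hx.1

theorem unnormalizedMarginal_ne_zero {S : Finset (ZMod N)} {y : ZMod N → ℝ}
    (hy : ∀ i ∈ S, 0 < y i) : unnormalizedMarginal β γ S y ≠ 0 := by
  intro h
  have hm : Measurable fun u => chainWeight β γ (Function.updateFinset y Sᶜ u) :=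
    measurable_chainWeight.comp measurable_updateFinset
  have hpos : ∀ᵐ u ∂Measure.pi fun _ : (Sᶜ : Finset (ZMod N)) => unitMeasure, ∀ i, 0 < u i :=
    ae_all_iff.2 fun i => (Measure.quasiMeasurePreserving_eval _ i).ae ae_unitMeasure_pos
  obtain ⟨u, hu, hu0⟩ := (hpos.and ((lintegral_eq_zero_iff hm).1 h)).exists
  refine chainWeight_ne_zero (fun i => ?_) hu0
  by_cases hi : i ∈ S
  · simpa [Function.updateFinset, hi] using hy i hi
  · simpa [Function.updateFinset, hi] using hu ⟨i, by simpa using hi⟩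

theorem unnormalizedMarginal_eq_lmarginal {S T : Finset (ZMod N)} (hST : Disjoint S T) :
    unnormalizedMarginal β γ S
      = ∫⋯∫⁻_T, unnormalizedMarginal β γ (S ∪ T) ∂fun _ => unitMeasure := by
  rw [unnormalizedMarginal, unnormalizedMarginal, ← lmarginal_union _ _ measurable_chainWeight]
  · congr 1
    ext i
    have : i ∈ S → i ∉ T := fun h => Finset.disjoint_left.1 hST h
    simp only [Finset.mem_compl, Finset.mem_union]
    tauto
  · exact Finset.disjoint_left.2 fun i hi => by simp [hi]

/-- Exchanging the values on two blocks only affects the contribution of the gaps. -/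
theorem unnormalizedMarginal_mul_le_swap (hN : N = (p + 1 + r) + (q + 1 + r'))
    {y w y₁ y₂ : ZMod N → ℝ} (hI : ∀ i ∈ arc a 0 (p + 1), y₁ i = y i ∧ y₂ i = w i)
    (hJ : ∀ j ∈ arc a (p + 1 + r) (q + 1), y₁ j = w j ∧ y₂ j = y j) {κ c : ℝ≥0∞}
    (h : bridge β γ r (y (a + p)) (y (a + (p + 1 + r : ℕ)))
        * bridge β γ r (w (a + p)) (w (a + (p + 1 + r : ℕ)))
        * (bridge β γ r' (y (a + (p + 1 + r + q : ℕ))) (y a)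
          * bridge β γ r' (w (a + (p + 1 + r + q : ℕ))) (w a)) * c
      ≤ κ * (bridge β γ r (y (a + p)) (w (a + (p + 1 + r : ℕ)))
        * bridge β γ r (w (a + p)) (y (a + (p + 1 + r : ℕ)))
        * (bridge β γ r' (y (a + (p + 1 + r + q : ℕ))) (w a)
          * bridge β γ r' (w (a + (p + 1 + r + q : ℕ))) (y a)))) :
    unnormalizedMarginal β γ (arc a 0 (p + 1) ∪ arc a (p + 1 + r) (q + 1)) w * c
        * unnormalizedMarginal β γ (arc a 0 (p + 1) ∪ arc a (p + 1 + r) (q + 1)) y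
      ≤ κ * (unnormalizedMarginal β γ (arc a 0 (p + 1) ∪ arc a (p + 1 + r) (q + 1)) y₁
          * unnormalizedMarginal β γ (arc a 0 (p + 1) ∪ arc a (p + 1 + r) (q + 1)) y₂) := by
  have hI' (k : ℕ) (hk : k ≤ p) := hI (a + k) ((add_natCast_mem_arc (by omega) (by omega)).2
    (by omega))
  have hJ' (k : ℕ) (hk : k ≤ q) := hJ (a + (p + 1 + r + k : ℕ))
    ((add_natCast_mem_arc (by omega) (by omega)).2 (by omega))
  have ha := hI' 0 (by omega)
  have hc := hJ' 0 (by omega)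
  rw [Nat.cast_zero, add_zero] at ha
  rw [add_zero] at hc
  simp only [unnormalizedMarginal, lmarginal_gaps_chainWeight hN]
  rw [segmentWeight_congr fun k hk => (hI' k hk).1, segmentWeight_congr fun k hk => (hI' k hk).2,
    segmentWeight_congr fun k hk => (hJ' k hk).1, segmentWeight_congr fun k hk => (hJ' k hk).2,
    ha.1, ha.2, hc.1, hc.2, (hI' p le_rfl).1, (hI' p le_rfl).2, (hJ' q le_rfl).1, (hJ' q le_rfl).2]
  -- The exchange permutes the four segment weights, so their product is common to both sides.
  convert mul_le_mul_right h (segmentWeight β γ (fun k => y (a + (k : ℕ))) p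
    * segmentWeight β γ (fun k => y (a + (p + 1 + r + k : ℕ))) q
    * (segmentWeight β γ (fun k => w (a + (k : ℕ))) p
      * segmentWeight β γ (fun k => w (a + (p + 1 + r + k : ℕ))) q)) using 1 <;> ring

theorem unnormalizedMarginal_mul_le_swap_of_crossRatioLE (hN : N = (p + 1 + r) + (q + 1 + r'))
    {δ : ℝ≥0} (h₁ : CrossRatioLE (bridge β γ r) δ) (h₂ : CrossRatioLE (bridge β γ r') δ)
    {y w y₁ y₂ : ZMod N → ℝ} (hI : ∀ i ∈ arc a 0 (p + 1), y₁ i = y i ∧ y₂ i = w i)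
    (hJ : ∀ j ∈ arc a (p + 1 + r) (q + 1), y₁ j = w j ∧ y₂ j = y j) :
    unnormalizedMarginal β γ (arc a 0 (p + 1) ∪ arc a (p + 1 + r) (q + 1)) w
        * unnormalizedMarginal β γ (arc a 0 (p + 1) ∪ arc a (p + 1 + r) (q + 1)) y
      ≤ ((1 + δ) ^ 2 : ℝ≥0) *
        (unnormalizedMarginal β γ (arc a 0 (p + 1) ∪ arc a (p + 1 + r) (q + 1)) y₁
          * unnormalizedMarginal β γ (arc a 0 (p + 1) ∪ arc a (p + 1 + r) (q + 1)) y₂) := by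
  have := unnormalizedMarginal_mul_le_swap (β := β) (γ := γ) (c := 1) (κ := ((1 + δ) ^ 2 : ℝ≥0))
    hN hI hJ ?_
  · rwa [mul_one] at this
  rw [mul_one]
  refine (mul_le_mul' (h₁.bridge_mul_bridge_le _ _ _ _)
    (h₂.bridge_mul_bridge_le _ _ _ _)).trans_eq ?_
  push_cast
  ring

theorem unnormalizedMarginal_mul_barrier_mul_le_swap (hβ : 0 ≤ β) (hγ : 0 ≤ γ)
    (hN : N = (p + 1 + r) + (q + 1 + r')) {δ : ℝ≥0}
    (hδ : 1 ≤ (1 + δ : ℝ≥0) * (minorization γ * minorization γ))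
    {y w y₁ y₂ : ZMod N → ℝ} (hI : ∀ i ∈ arc a 0 (p + 1), y₁ i = y i ∧ y₂ i = w i)
    (hJ : ∀ j ∈ arc a (p + 1 + r) (q + 1), y₁ j = w j ∧ y₂ j = y j) :
    unnormalizedMarginal β γ (arc a 0 (p + 1) ∪ arc a (p + 1 + r) (q + 1)) w
        * (barrier γ (w (a + p)) * barrier γ (w (a + (p + 1 + r : ℕ)))
          * barrier γ (w (a + (p + 1 + r + q : ℕ))) * barrier γ (w a))
        * unnormalizedMarginal β γ (arc a 0 (p + 1) ∪ arc a (p + 1 + r) (q + 1)) y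
      ≤ ((1 + δ) ^ 2 : ℝ≥0) *
        (unnormalizedMarginal β γ (arc a 0 (p + 1) ∪ arc a (p + 1 + r) (q + 1)) y₁
          * unnormalizedMarginal β γ (arc a 0 (p + 1) ∪ arc a (p + 1 + r) (q + 1)) y₂) := by
  refine unnormalizedMarginal_mul_le_swap hN hI hJ ?_
  have k₁ := bridge_mul_bridge_mul_barrier_le hβ hγ hδ r (y (a + p)) (w (a + p))
    (y (a + (p + 1 + r : ℕ))) (w (a + (p + 1 + r : ℕ)))
  have k₂ := bridge_mul_bridge_mul_barrier_le hβ hγ hδ r' (y (a + (p + 1 + r + q : ℕ)))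
    (w (a + (p + 1 + r + q : ℕ))) (y a) (w a)
  refine le_of_eq_of_le ?_ ((mul_le_mul' k₁ k₂).trans_eq ?_)
  · ring
  · push_cast; ring

/-- Chebyshev's inequality is applied once per factor; multiplying by a barrier keeps the integrand
monotone. The four sites may coincide, as they do in one-site blocks, so the factors are added in
turn. -/
theorem minorization_pow_mul_lmarginal_le (hβ : 0 ≤ β) (hγ : 0 ≤ γ) (i j k l : ZMod N)
    (y : ZMod N → ℝ) :
    minorization γ ^ 4 * (∫⋯∫⁻_Finset.univ, chainWeight β γ ∂fun _ => unitMeasure) y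
      ≤ (∫⋯∫⁻_Finset.univ, (fun y => chainWeight β γ y * barrier γ (y i) * barrier γ (y j)
          * barrier γ (y k) * barrier γ (y l)) ∂fun _ => unitMeasure) y := by
  have step {P : (ZMod N → ℝ) → ℝ≥0∞} (hP : Monotone P) (hPm : Measurable P) (i : ZMod N) :
      minorization γ * (∫⋯∫⁻_Finset.univ, P ∂fun _ => unitMeasure) y
        ≤ (∫⋯∫⁻_Finset.univ, (fun y => P y * barrier γ (y i)) ∂fun _ => unitMeasure) y :=
    (mul_le_mul_left (minorization_le_lintegral hγ) _).trans <|
      lintegral_mul_lmarginal_le (Finset.mem_univ i) (barrier_mono hγ) hP hPm y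
  have hmono {P : (ZMod N → ℝ) → ℝ≥0∞} (hP : Monotone P) (i : ZMod N) :
      Monotone fun y => P y * barrier γ (y i) :=
    fun _ _ h => mul_le_mul' (hP h) (barrier_mono hγ (h i))
  have hm {P : (ZMod N → ℝ) → ℝ≥0∞} (hP : Measurable P) (i : ZMod N) :
      Measurable fun y => P y * barrier γ (y i) := by fun_prop
  have m₀ := chainWeight_mono (N := N) hβ hγ
  have n₀ := measurable_chainWeight (N := N) (β := β) (γ := γ)
  have s₁ := step m₀ n₀ i
  have s₂ := step (hmono m₀ i) (hm n₀ i) j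
  have s₃ := step (hmono (hmono m₀ i) j) (hm (hm n₀ i) j) k
  have s₄ := step (hmono (hmono (hmono m₀ i) j) k) (hm (hm (hm n₀ i) j) k) l
  refine le_trans ?_ s₄
  calc _ = minorization γ * (minorization γ * (minorization γ * (minorization γ
        * (∫⋯∫⁻_Finset.univ, chainWeight β γ ∂fun _ => unitMeasure) y))) := by ring
    _ ≤ _ := by
      gcongr
      refine le_trans ?_ s₃
      gcongr
      refine le_trans ?_ s₂
      gcongr

theorem unnormalizedMarginal_left (hN : N = (p + 1 + r) + (q + 1 + r')) :
    unnormalizedMarginal β γ (arc a 0 (p + 1))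
      = ∫⋯∫⁻_arc a (p + 1 + r) (q + 1), unnormalizedMarginal β γ
        (arc a 0 (p + 1) ∪ arc a (p + 1 + r) (q + 1)) ∂fun _ => unitMeasure :=
  unnormalizedMarginal_eq_lmarginal (disjoint_arc_arc (by omega) (by omega))

theorem unnormalizedMarginal_right (hN : N = (p + 1 + r) + (q + 1 + r')) :
    unnormalizedMarginal β γ (arc a (p + 1 + r) (q + 1))
      = ∫⋯∫⁻_arc a 0 (p + 1), unnormalizedMarginal β γ
        (arc a 0 (p + 1) ∪ arc a (p + 1 + r) (q + 1)) ∂fun _ => unitMeasure := by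
  have hd : Disjoint (arc a 0 (p + 1)) (arc a (p + 1 + r) (q + 1)) :=
    disjoint_arc_arc (by omega) (by omega)
  rw [unnormalizedMarginal_eq_lmarginal hd.symm, Finset.union_comm]

theorem unnormalizedMarginal_empty (S : Finset (ZMod N)) :
    unnormalizedMarginal β γ ∅ = ∫⋯∫⁻_S, unnormalizedMarginal β γ S ∂fun _ => unitMeasure := by
  rw [unnormalizedMarginal_eq_lmarginal (Finset.disjoint_empty_left S), Finset.empty_union]

/-- The joint weight of two blocks is bounded by the product of the marginal weights, up to the
cross-ratios of the gaps. -/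
theorem unnormalizedMarginal_union_le (hβ : 0 ≤ β) (hγ : 0 ≤ γ)
    (hN : N = (p + 1 + r) + (q + 1 + r')) {δ : ℝ≥0} (h₁ : CrossRatioLE (bridge β γ r) δ)
    (h₂ : CrossRatioLE (bridge β γ r') δ) (y : ZMod N → ℝ) :
    unnormalizedMarginal β γ ∅ y
        * unnormalizedMarginal β γ (arc a 0 (p + 1) ∪ arc a (p + 1 + r) (q + 1)) y
      ≤ ((1 + δ) ^ 2 : ℝ≥0) * (unnormalizedMarginal β γ (arc a 0 (p + 1)) y
        * unnormalizedMarginal β γ (arc a (p + 1 + r) (q + 1)) y) := by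
  have hd : Disjoint (arc a 0 (p + 1)) (arc a (p + 1 + r) (q + 1)) :=
    disjoint_arc_arc (by omega) (by omega)
  rw [unnormalizedMarginal_empty (arc a 0 (p + 1) ∪ arc a (p + 1 + r) (q + 1)),
    unnormalizedMarginal_left hN, unnormalizedMarginal_right hN]
  refine lmarginal_union_mul_le (measurable_unnormalizedMarginal _)
    (measurable_unnormalizedMarginal _) hd (unnormalizedMarginal_ne_top hβ hγ _ y) fun v u => ?_
  obtain ⟨hI, hJ⟩ := updateFinset_swap hd y v u
  exact unnormalizedMarginal_mul_le_swap_of_crossRatioLE hN h₁ h₂ hI hJ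

/-- The product of the marginal weights of two blocks is bounded by the joint weight, up to the
cross-ratios of the gaps. -/
theorem le_unnormalizedMarginal_union (hβ : 0 ≤ β) (hγ : 0 ≤ γ)
    (hN : N = (p + 1 + r) + (q + 1 + r')) {δ : ℝ≥0} (h₁ : CrossRatioLE (bridge β γ r) δ)
    (h₂ : CrossRatioLE (bridge β γ r') δ) (y : ZMod N → ℝ) :
    unnormalizedMarginal β γ (arc a 0 (p + 1)) y
        * unnormalizedMarginal β γ (arc a (p + 1 + r) (q + 1)) y
      ≤ ((1 + δ) ^ 2 : ℝ≥0) * (unnormalizedMarginal β γ ∅ y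
        * unnormalizedMarginal β γ (arc a 0 (p + 1) ∪ arc a (p + 1 + r) (q + 1)) y) := by
  have hd : Disjoint (arc a 0 (p + 1)) (arc a (p + 1 + r) (q + 1)) :=
    disjoint_arc_arc (by omega) (by omega)
  rw [unnormalizedMarginal_empty (arc a 0 (p + 1) ∪ arc a (p + 1 + r) (q + 1)),
    unnormalizedMarginal_left hN, unnormalizedMarginal_right hN]
  refine le_lmarginal_union_mul (measurable_unnormalizedMarginal _)
    (measurable_unnormalizedMarginal _) hd (unnormalizedMarginal_ne_top hβ hγ _ y) fun v u => ?_
  obtain ⟨hI, hJ⟩ := updateFinset_swap hd y v u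
  -- The exchange is an involution, so the reverse bound is the same swap inequality started from
  -- the mixed configurations.
  rw [mul_comm (unnormalizedMarginal _ _ _ (Function.updateFinset y _ u)),
    mul_comm (unnormalizedMarginal _ _ _ (Function.updateFinset _ _ u))]
  exact unnormalizedMarginal_mul_le_swap_of_crossRatioLE hN h₁ h₂
    (fun i hi => ⟨(hI i hi).1.symm, (hI i hi).2.symm⟩)
    fun j hj => ⟨(hJ j hj).2.symm, (hJ j hj).1.symm⟩

/-- The joint weight of two arbitrary blocks is bounded by a multiple of the product of the marginal
weights. -/
theorem unnormalizedMarginal_union_le_of_minorization (hβ : 0 ≤ β) (hγ : 0 ≤ γ)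
    (hN : N = (p + 1 + r) + (q + 1 + r')) {δ : ℝ≥0}
    (hδ : 1 ≤ (1 + δ : ℝ≥0) * (minorization γ * minorization γ)) (y : ZMod N → ℝ) :
    unnormalizedMarginal β γ ∅ y
        * unnormalizedMarginal β γ (arc a 0 (p + 1) ∪ arc a (p + 1 + r) (q + 1)) y
      ≤ ((1 + δ) ^ 4 : ℝ≥0) * (unnormalizedMarginal β γ (arc a 0 (p + 1)) y
        * unnormalizedMarginal β γ (arc a (p + 1 + r) (q + 1)) y) := by
  have hd : Disjoint (arc a 0 (p + 1)) (arc a (p + 1 + r) (q + 1)) :=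
    disjoint_arc_arc (by omega) (by omega)
  set S := arc a 0 (p + 1) ∪ arc a (p + 1 + r) (q + 1) with hS
  set Φ : (ZMod N → ℝ) → ℝ≥0∞ := fun w => barrier γ (w (a + p))
    * barrier γ (w (a + (p + 1 + r : ℕ))) * barrier γ (w (a + (p + 1 + r + q : ℕ)))
    * barrier γ (w a) with hΦ
  have hmain : (∫⋯∫⁻_S, (fun w => unnormalizedMarginal β γ S w * Φ w) ∂fun _ => unitMeasure) y
      * unnormalizedMarginal β γ S y
      ≤ ((1 + δ) ^ 2 : ℝ≥0) * (unnormalizedMarginal β γ (arc a 0 (p + 1)) y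
        * unnormalizedMarginal β γ (arc a (p + 1 + r) (q + 1)) y) := by
    rw [unnormalizedMarginal_left hN, unnormalizedMarginal_right hN]
    refine lmarginal_union_mul_le (measurable_unnormalizedMarginal _)
      ((measurable_unnormalizedMarginal _).mul (by fun_prop)) hd
      (unnormalizedMarginal_ne_top hβ hγ _ y) fun v u => ?_
    obtain ⟨hI, hJ⟩ := updateFinset_swap hd y v u
    -- The weight `Φ` supplies the barriers that `bridge_mul_bridge_mul_barrier_le` requires, two
    -- for each gap.
    exact unnormalizedMarginal_mul_barrier_mul_le_swap hβ hγ hN hδ hI hJ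
  have hint : (∫⋯∫⁻_S, (fun w => unnormalizedMarginal β γ S w * Φ w) ∂fun _ => unitMeasure) y
      = (∫⋯∫⁻_Finset.univ, (fun w => chainWeight β γ w * Φ w) ∂fun _ => unitMeasure) y := by
    have hm : Measurable fun w => chainWeight β γ w * Φ w :=
      measurable_chainWeight.mul (by fun_prop)
    rw [← Finset.union_compl S, lmarginal_union _ _ hm disjoint_compl_right]
    congr 1
    funext w
    rw [lmarginal_mul_of_dependsOn measurable_chainWeight]
    · rfl
    · intro w w' h
      have hmem (k : ℕ) (hk : k ∈ ({0, p, p + 1 + r, p + 1 + r + q} : Finset ℕ)) :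
          w (a + k) = w' (a + k) := by
        refine h _ ?_
        have hk' : k < N := by simp at hk; omega
        rw [mem_compl_iff, Finset.mem_coe, Finset.mem_compl, not_not, hS, Finset.mem_union,
          add_natCast_mem_arc (by omega) hk', add_natCast_mem_arc (by omega) hk']
        simp at hk
        omega
      have h0 := hmem 0 (by simp)
      rw [Nat.cast_zero, add_zero] at h0
      simp only [hΦ]
      rw [hmem p (by simp), hmem (p + 1 + r) (by simp), hmem (p + 1 + r + q) (by simp), h0]
  have hcheb := minorization_pow_mul_lmarginal_le hβ hγ (a + (p : ZMod N))
    (a + ((p + 1 + r : ℕ) : ZMod N)) (a + ((p + 1 + r + q : ℕ) : ZMod N)) a y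
  have hempty : unnormalizedMarginal β γ ∅ y
      = (∫⋯∫⁻_Finset.univ, chainWeight β γ ∂fun _ => unitMeasure) y := by
    rw [unnormalizedMarginal, Finset.compl_empty]
  rw [← hempty] at hcheb
  -- Inserting `Φ` costs `minorization γ ^ 4`, paid for by `(1 + δ) ^ 2`; the two gaps contribute
  -- the other `(1 + δ) ^ 2`.
  calc unnormalizedMarginal β γ ∅ y * unnormalizedMarginal β γ S y
      = 1 * 1 * (unnormalizedMarginal β γ ∅ y * unnormalizedMarginal β γ S y) := by ring
    _ ≤ ((1 + δ : ℝ≥0) * (minorization γ * minorization γ))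
        * ((1 + δ : ℝ≥0) * (minorization γ * minorization γ))
        * (unnormalizedMarginal β γ ∅ y * unnormalizedMarginal β γ S y) := by gcongr
    _ = ((1 + δ) ^ 2 : ℝ≥0) * ((minorization γ ^ 4 * unnormalizedMarginal β γ ∅ y)
        * unnormalizedMarginal β γ S y) := by push_cast; ring
    _ ≤ ((1 + δ) ^ 2 : ℝ≥0) *
        ((∫⋯∫⁻_S, (fun w => unnormalizedMarginal β γ S w * Φ w) ∂fun _ => unitMeasure) y
          * unnormalizedMarginal β γ S y) := by
      rw [hint]
      simp only [hΦ, ← mul_assoc (chainWeight _ _ _)]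
      gcongr
    _ ≤ ((1 + δ) ^ 2 : ℝ≥0) * (((1 + δ) ^ 2 : ℝ≥0) * _) := by gcongr
    _ = _ := by push_cast; ring

end Comparison

/-! ### Densities -/

section Density

variable {N : ℕ} [NeZero N] {β γ : ℝ}

theorem restrict_Icc_zero_one (ι : Type*) [Fintype ι] :
    (volume : Measure (ι → ℝ)).restrict (Icc 0 1) = Measure.pi fun _ => unitMeasure := by
  rw [← pi_univ_Icc, volume_pi, Measure.restrict_pi_pi]
  rfl

theorem weight_eq_toReal (y : ZMod N → ℝ) : weight β γ y = (chainWeight β γ y).toReal := by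
  rw [← ofReal_weight, ENNReal.toReal_ofReal]
  exact indicator_nonneg (fun _ _ => (Real.exp_pos _).le) _

theorem integral_weight_updateFinset (hβ : 0 ≤ β) (hγ : 0 ≤ γ) (S : Finset (ZMod N))
    (y : ZMod N → ℝ) :
    ∫ u in Icc (0 : ↥Sᶜ → ℝ) 1, weight β γ (Function.updateFinset y Sᶜ u)
      = (unnormalizedMarginal β γ S y).toReal := by
  have hm : Measurable fun u => chainWeight β γ (Function.updateFinset y Sᶜ u) :=
    measurable_chainWeight.comp measurable_updateFinset
  simp_rw [weight_eq_toReal]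
  rw [restrict_Icc_zero_one, integral_toReal hm.aemeasurable
    (ae_of_all _ fun _ => (chainWeight_le_one hβ hγ _).trans_lt ENNReal.one_lt_top)]
  rfl

theorem partitionFunction_eq (hβ : 0 ≤ β) (hγ : 0 ≤ γ) (y : ZMod N → ℝ) :
    partitionFunction N β γ = (unnormalizedMarginal β γ ∅ y).toReal := by
  simp_rw [partitionFunction, weight_eq_toReal]
  rw [restrict_Icc_zero_one, integral_toReal measurable_chainWeight.aemeasurable
    (ae_of_all _ fun _ => (chainWeight_le_one hβ hγ _).trans_lt ENNReal.one_lt_top),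
    unnormalizedMarginal, Finset.compl_empty, lmarginal_univ]

theorem marginalDensity_eq (hβ : 0 ≤ β) (hγ : 0 ≤ γ) (S : Finset (ZMod N)) (y : ZMod N → ℝ) :
    marginalDensity β γ S y
      = (unnormalizedMarginal β γ S y).toReal / (unnormalizedMarginal β γ ∅ y).toReal := by
  rw [← partitionFunction_eq hβ hγ, ← integral_weight_updateFinset hβ hγ, ← integral_div]
  rfl

theorem marginalDensity_pos (hβ : 0 ≤ β) (hγ : 0 ≤ γ) {S : Finset (ZMod N)} {y : ZMod N → ℝ}
    (hy : ∀ i ∈ S, 0 < y i) : 0 < marginalDensity β γ S y := by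
  rw [marginalDensity_eq hβ hγ]
  exact div_pos
    (ENNReal.toReal_pos (unnormalizedMarginal_ne_zero hy) (unnormalizedMarginal_ne_top hβ hγ _ _))
    (ENNReal.toReal_pos (unnormalizedMarginal_ne_zero (by simp))
      (unnormalizedMarginal_ne_top hβ hγ _ _))

end Density

/-! ### The rate of decay -/

section Rate

variable {γ : ℝ}

theorem minorization_ne_zero (γ : ℝ) : minorization γ ≠ 0 := by
  intro h
  rw [minorization, lintegral_eq_zero_iff (by fun_prop)] at h
  obtain ⟨x, hx, hx0⟩ := (ae_unitMeasure_pos.and h).exists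
  exact mul_ne_zero (barrier_ne_zero hx) (barrier_ne_zero hx) hx0

theorem tendsto_minorization : Tendsto minorization (𝓝[>] 0) (𝓝 1) := by
  have h : Tendsto minorization (𝓝[>] 0) (𝓝 (∫⁻ _, 1 ∂unitMeasure)) := by
    refine tendsto_lintegral_filter_of_dominated_convergence (fun _ => 1)
      (Eventually.of_forall fun γ => by fun_prop) ?_ (by simp) ?_
    · filter_upwards [self_mem_nhdsWithin] with γ hγ
      exact ae_of_all _ fun y => mul_le_one' (barrier_le_one (le_of_lt hγ) y)
        (barrier_le_one (le_of_lt hγ) y)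
    · filter_upwards [ae_unitMeasure_pos] with y hy
      simp only [barrier_of_pos hy]
      have hc : Continuous fun γ : ℝ => ENNReal.ofReal (Real.exp (-(γ / y)))
          * ENNReal.ofReal (Real.exp (-(γ / y))) := by
        simp_rw [← ENNReal.ofReal_mul (Real.exp_pos _).le]
        exact ENNReal.continuous_ofReal.comp (by fun_prop)
      simpa using (hc.tendsto 0).mono_left nhdsWithin_le_nhds
  simpa using h

/-- A bound, minus one, for the cross-ratios of bridges with one site; it is positive also for
`γ = 0`. -/
def oscillation (γ : ℝ) : ℝ :=
  ((minorization γ).toReal ^ 2)⁻¹ - 1 + if γ = 0 then 1 else γ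

/-- Half the logarithm of the contraction rate of bridges with one site. -/
def decayRate (γ : ℝ) : ℝ := -Real.log (oscillation γ / (2 + oscillation γ)) / 2

theorem minorization_toReal_pos (hγ : 0 ≤ γ) : 0 < (minorization γ).toReal :=
  ENNReal.toReal_pos (minorization_ne_zero γ)
    ((minorization_le_one hγ).trans_lt ENNReal.one_lt_top).ne

/-- Strict positivity matters: `oscillation` is a denominator in `decayConstant`, and at value `0`
the convention `Real.log 0 = 0` would make the decay rate vanish. -/
theorem oscillation_pos (hγ : 0 ≤ γ) : 0 < oscillation γ := by
  have h0 := minorization_toReal_pos hγ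
  have h1 : (minorization γ).toReal ≤ 1 :=
    ENNReal.toReal_le_of_le_ofReal zero_le_one (by simpa using minorization_le_one hγ)
  have h2 : 1 ≤ ((minorization γ).toReal ^ 2)⁻¹ :=
    (one_le_inv₀ (by positivity)).2 (pow_le_one₀ h0.le h1)
  have h3 : 0 < if γ = 0 then 1 else γ := by
    split_ifs with h
    exacts [one_pos, lt_of_le_of_ne hγ (Ne.symm h)]
  rw [oscillation]
  linarith

theorem one_le_oscillation (hγ : 0 ≤ γ) :
    1 ≤ ((1 + (oscillation γ).toNNReal : ℝ≥0) : ℝ≥0∞) * (minorization γ * minorization γ) := by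
  have h0 := minorization_toReal_pos hγ
  have htop := ((minorization_le_one hγ).trans_lt ENNReal.one_lt_top).ne
  rw [← ENNReal.ofReal_toReal htop, ← ENNReal.ofReal_mul h0.le,
    show ((1 + (oscillation γ).toNNReal : ℝ≥0) : ℝ≥0∞) = ENNReal.ofReal (1 + oscillation γ) by
      rw [ENNReal.ofReal_add zero_le_one (oscillation_pos hγ).le]; simp; rfl,
    ← ENNReal.ofReal_mul (by linarith [oscillation_pos hγ]), ENNReal.one_le_ofReal]
  have h3 : 0 ≤ if γ = 0 then 1 else γ := by
    split_ifs
    exacts [zero_le_one, hγ]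
  calc 1 = ((minorization γ).toReal ^ 2)⁻¹
        * ((minorization γ).toReal * (minorization γ).toReal) := by field_simp
    _ ≤ _ := by
      gcongr
      rw [oscillation]
      linarith

theorem exp_decayRate (hγ : 0 ≤ γ) :
    Real.exp (-(2 * decayRate γ)) = oscillation γ / (2 + oscillation γ) := by
  have := oscillation_pos hγ
  rw [decayRate, mul_div_cancel₀ _ two_ne_zero, neg_neg, Real.exp_log (by positivity)]

theorem decayRate_pos (hγ : 0 ≤ γ) : 0 < decayRate γ := by
  have := oscillation_pos hγ
  have : Real.log (oscillation γ / (2 + oscillation γ)) < 0 :=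
    Real.log_neg (by positivity) ((div_lt_one (by positivity)).2 (by linarith))
  rw [decayRate]
  linarith

theorem tendsto_decayRate : Tendsto decayRate (𝓝[>] 0) atTop := by
  have h1 : Tendsto oscillation (𝓝[>] 0) (𝓝 0) := by
    have h := ((((ENNReal.tendsto_toReal ENNReal.one_ne_top).comp tendsto_minorization).pow
      2).inv₀ (by simp)).sub_const 1
    have h' := h.add (tendsto_nhdsWithin_of_tendsto_nhds (s := Ioi (0 : ℝ)) tendsto_id)
    simp only [ENNReal.toReal_one, one_pow, inv_one, sub_self, add_zero] at h'
    refine h'.congr' ?_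
    filter_upwards [self_mem_nhdsWithin] with γ hγ
    simp [oscillation, (ne_of_gt hγ : γ ≠ 0)]
  have h2 : Tendsto (fun γ => oscillation γ / (2 + oscillation γ)) (𝓝[>] 0) (𝓝[>] 0) := by
    refine tendsto_nhdsWithin_iff.2 ⟨?_, ?_⟩
    · simpa [Pi.div_def] using h1.div (h1.const_add 2) (by simp)
    · filter_upwards [self_mem_nhdsWithin] with γ hγ
      have := oscillation_pos (le_of_lt hγ)
      exact div_pos this (by positivity)
  exact (tendsto_neg_atBot_atTop.comp (Real.tendsto_log_nhdsGT_zero.comp h2)).atTop_div_const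
    two_pos

/-- The geometric decay of cross-ratios in terms of `decayRate`. -/
theorem pow_half_le (hγ : 0 ≤ γ) (s : ℕ) :
    (oscillation γ / (2 + oscillation γ)) ^ ((s - 1) / 2)
      ≤ (2 + oscillation γ) / oscillation γ * Real.exp (-(decayRate γ * s)) := by
  -- Rounding loses at most one contraction, or two units of `s`; the prefactor `exp (2 * decayRate
  -- γ)` absorbs it. Truncated subtraction keeps this valid at `s = 0`.
  have hs : (s : ℝ) ≤ 2 * ((s - 1) / 2 : ℕ) + 2 := by
    have : s ≤ 2 * ((s - 1) / 2) + 2 := by omega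
    exact_mod_cast this
  rw [← inv_div (oscillation γ), ← exp_decayRate hγ, ← Real.exp_neg, ← Real.exp_nat_mul,
    ← Real.exp_add, Real.exp_le_exp]
  nlinarith [decayRate_pos hγ]

end Rate

/-! ### Decay of correlations -/

/-- The prefactor in the decay of correlations. -/
def decayConstant (γ : ℝ) : ℝ :=
  (1 + oscillation γ) ^ 4 * ((2 + oscillation γ) / oscillation γ)

theorem decayConstant_pos {γ : ℝ} (hγ : 0 ≤ γ) : 0 < decayConstant γ := by
  have := oscillation_pos hγ
  rw [decayConstant]
  positivity

section Decay

variable {N : ℕ} [NeZero N] {β γ : ℝ} {a : ZMod N} {p r q r' : ℕ}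

/-- The joint weight is within a factor `K` of the product, which gives a relative error of at most
`K - 1`. If `1 ≤ B`, the lower comparison is superfluous because the conditional density is
nonnegative. All is kept in product form since the marginal of `I` may vanish. -/
theorem abs_conditionalDensity_sub_le (hβ : 0 ≤ β) (hγ : 0 ≤ γ) {I J : Finset (ZMod N)}
    {y : ZMod N → ℝ} (hJ : ∀ j ∈ J, 0 < y j) {K : ℝ≥0}
    (hup : unnormalizedMarginal β γ ∅ y * unnormalizedMarginal β γ (I ∪ J) y
      ≤ K * (unnormalizedMarginal β γ I y * unnormalizedMarginal β γ J y))
    {B : ℝ} (hB0 : 0 ≤ B) (hB : K ≤ 1 + B) (hlow : 1 ≤ B ∨ unnormalizedMarginal β γ I y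
      * unnormalizedMarginal β γ J y
      ≤ K * (unnormalizedMarginal β γ ∅ y * unnormalizedMarginal β γ (I ∪ J) y)) :
    |conditionalDensity β γ I J y - marginalDensity β γ I y| ≤ B * marginalDensity β γ I y := by
  have htop := unnormalizedMarginal_ne_top (N := N) hβ hγ
  have hZ := ENNReal.toReal_pos (unnormalizedMarginal_ne_zero (β := β) (γ := γ) (y := y) (S := ∅)
    (by simp)) (htop _ _)
  have hJ' := ENNReal.toReal_pos (unnormalizedMarginal_ne_zero (β := β) (γ := γ) hJ) (htop _ _)
  have hup' := ENNReal.toReal_mono (by finiteness [htop I y, htop J y]) hup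
  simp only [conditionalDensity, marginalDensity_eq hβ hγ]
  rw [div_div_div_cancel_right₀ hZ.ne']
  simp only [ENNReal.toReal_mul, ENNReal.coe_toReal] at hup'
  have hlow' : 1 ≤ B ∨ (unnormalizedMarginal β γ I y).toReal * (unnormalizedMarginal β γ J y).toReal
      ≤ K * ((unnormalizedMarginal β γ ∅ y).toReal
        * (unnormalizedMarginal β γ (I ∪ J) y).toReal) := by
    refine hlow.imp_right fun h => ?_
    have := ENNReal.toReal_mono (by finiteness [htop (I ∪ J) y, htop ∅ y]) h
    simpa only [ENNReal.toReal_mul, ENNReal.coe_toReal] using this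
  have hA := ENNReal.toReal_nonneg (a := unnormalizedMarginal β γ (I ∪ J) y)
  have hC := ENNReal.toReal_nonneg (a := unnormalizedMarginal β γ I y)
  generalize (unnormalizedMarginal β γ ∅ y).toReal = Z at *
  generalize (unnormalizedMarginal β γ I y).toReal = f at *
  generalize (unnormalizedMarginal β γ J y).toReal = g at *
  generalize (unnormalizedMarginal β γ (I ∪ J) y).toReal = h at *
  have k1 : h / g ≤ K * (f / Z) := by
    rw [← mul_div_assoc, div_le_div_iff₀ hJ' hZ]
    linarith
  have hf : 0 ≤ f / Z := by positivity
  have hg : 0 ≤ h / g := by positivity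
  have k3 : (K : ℝ) * (f / Z) ≤ (1 + B) * (f / Z) := mul_le_mul_of_nonneg_right hB hf
  rw [abs_sub_le_iff]
  refine ⟨by linarith, ?_⟩
  rcases hlow' with h1 | h1
  · nlinarith
  · have k2 : f / Z ≤ K * (h / g) := by
      rw [← mul_div_assoc, div_le_div_iff₀ hZ hJ']
      linarith
    have k4 : (K : ℝ) * (h / g) ≤ (1 + B) * (h / g) := mul_le_mul_of_nonneg_right hB hg
    rcases le_total (f / Z) (h / g) with h2 | h2
    · nlinarith
    · nlinarith [mul_le_mul_of_nonneg_left h2 hB0]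

/-- Exponential decay of correlations between two blocks of the chain. -/
theorem abs_conditionalDensity_sub_marginalDensity_le (hβ : 0 ≤ β) (hγ : 0 ≤ γ)
    {I J : Finset (ZMod N)} (hI : IsBlock I) (hJ : IsBlock J) (hI0 : I.Nonempty)
    (hJ0 : J.Nonempty) (hIJ : Disjoint I J) {y : ZMod N → ℝ} (hy : ∀ j ∈ J, 0 < y j) :
    |conditionalDensity β γ I J y - marginalDensity β γ I y|
      ≤ decayConstant γ * Real.exp (-(decayRate γ * separation I J)) * marginalDensity β γ I y := by
  obtain ⟨a, p, r, q, r', hN, rfl, rfl⟩ := hI.exists_arcs hJ hI0 hJ0 hIJ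
  have hl := separation_le_left (a := a) hN
  have hr := separation_le_right (a := a) hN
  set s := separation (arc a 0 (p + 1)) (arc a (p + 1 + r) (q + 1))
  have ho := oscillation_pos hγ
  have hδ := one_le_oscillation hγ
  set δ := (oscillation γ).toNNReal with hδ_def
  have hδo : (δ : ℝ) = oscillation γ := Real.coe_toNNReal _ ho.le
  have hdecay : (δ / (2 + δ) : ℝ) ^ ((s - 1) / 2)
      ≤ (2 + δ) / δ * Real.exp (-(decayRate γ * s)) := by
    rw [hδo]
    exact pow_half_le hγ s
  rw [decayConstant, mul_assoc ((1 + oscillation γ) ^ 4), ← hδo]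
  rw [← hδo] at ho
  have hB0 : (0 : ℝ) ≤ (1 + δ) ^ 4 * ((2 + δ) / δ * Real.exp (-(decayRate γ * s))) := by positivity
  -- At separation `0` the prefactor is at least `1`, so only the upper bound by minorization is
  -- needed.
  rcases Nat.eq_zero_or_pos s with hs | hs
  · have h1 : (1 : ℝ) ≤ (2 + δ) / δ := (one_le_div ho).2 (by linarith)
    have h2 : (1 : ℝ) ≤ (1 + δ) ^ 4 := one_le_pow₀ (by linarith)
    have h3 : (1 + δ : ℝ) ^ 4 ≤ (1 + δ) ^ 4 * ((2 + δ) / δ * Real.exp (-(decayRate γ * s))) := by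
      rw [hs]
      simpa using le_mul_of_one_le_right (zero_le_one.trans h2) h1
    refine abs_conditionalDensity_sub_le hβ hγ hy
      (unnormalizedMarginal_union_le_of_minorization hβ hγ hN hδ y) hB0 ?_ (.inl (h2.trans h3))
    push_cast
    linarith
  · set ρ : ℝ≥0 := δ / (2 + δ) with hρ
    set m := (s - 1) / 2
    have hρ1 : ρ ≤ 1 := div_le_one_of_le₀ le_add_self (by positivity)
    -- One site of the gap secures the initial bound `δ`, and every further pair contracts it; hence
    -- the exponent `(s - 1) / 2`.
    have hcross {n : ℕ} (hn : s ≤ n) : CrossRatioLE (bridge β γ n) (δ * ρ ^ m) := by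
      obtain ⟨k, rfl⟩ := Nat.exists_eq_add_of_le' (hs.trans_le hn)
      refine (crossRatioLE_bridge hβ hγ hδ k).mono ?_
      have : m ≤ k / 2 := Nat.div_le_div_right (by omega)
      exact mul_le_mul' le_rfl (pow_le_pow_of_le_one zero_le hρ1 this)
    have hup := unnormalizedMarginal_union_le (a := a) hβ hγ hN (hcross hl) (hcross hr) y
    have hlow := le_unnormalizedMarginal_union (a := a) hβ hγ hN (hcross hl) (hcross hr) y
    refine abs_conditionalDensity_sub_le hβ hγ hy hup hB0 ?_ (.inr hlow)
    have hx0 : (0 : ℝ) ≤ (ρ : ℝ) ^ m := by positivity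
    have hx1 : (ρ : ℝ) ^ m ≤ 1 := pow_le_one₀ ρ.2 (by exact_mod_cast hρ1)
    have hx2 : (ρ : ℝ) ^ m ≤ (2 + δ) / δ * Real.exp (-(decayRate γ * s)) := by
      simpa [hρ] using hdecay
    -- The square comes from the two gaps. Its excess over `1` is linear in `ρ ^ m` up to a factor
    -- `2 * δ + δ ^ 2`, which is below the constant `(1 + δ) ^ 4` already needed at separation `0`.
    calc (((1 + δ * ρ ^ m) ^ 2 : ℝ≥0) : ℝ)
        = 1 + (2 * δ + δ ^ 2 * (ρ : ℝ) ^ m) * (ρ : ℝ) ^ m := by push_cast; ring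
      _ ≤ 1 + (1 + δ : ℝ) ^ 4 * (ρ : ℝ) ^ m := by
        gcongr
        have : (δ : ℝ) ^ 2 * (ρ : ℝ) ^ m ≤ δ ^ 2 := mul_le_of_le_one_right (by positivity) hx1
        have h3 : (0 : ℝ) ≤ δ ^ 3 := by positivity
        have h4 : (0 : ℝ) ≤ δ ^ 4 := by positivity
        nlinarith
      _ ≤ _ := by gcongr

end Decay

end CoulombChain

end

theorem mainTheorem1 :
    ∃ (C : ℝ → ℝ → ℝ) (α : ℝ → ℝ),
      (∀ β γ : ℝ, 0 < β → 0 ≤ γ → 0 < C β γ) ∧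
      (∀ γ : ℝ, 0 ≤ γ → 0 < α γ) ∧
      (∀ (β γ : ℝ), 0 < β → 0 ≤ γ →
        ∀ (N : ℕ) [NeZero N] (I J : Finset (ZMod N)),
          CoulombChain.IsBlock I → CoulombChain.IsBlock J →
          I.Nonempty → J.Nonempty → Disjoint I J →
          ∀ y : ZMod N → ℝ,
            (∀ i ∈ I, y i ∈ Set.Icc (0 : ℝ) 1) → (∀ j ∈ J, y j ∈ Set.Ioc (0 : ℝ) 1) →
            0 < CoulombChain.marginalDensity β γ J y ∧
            |CoulombChain.conditionalDensity β γ I J y - CoulombChain.marginalDensity β γ I y|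
              ≤ C β γ * Real.exp (-(α γ * (CoulombChain.separation I J : ℝ)))
                * CoulombChain.marginalDensity β γ I y) ∧
      Tendsto α (𝓝[>] 0) atTop := by
  open CoulombChain in
  refine ⟨fun _ => decayConstant, decayRate, fun _ _ _ hγ => decayConstant_pos hγ,
    fun _ hγ => decayRate_pos hγ, fun β γ hβ hγ N _ I J hI hJ hI0 hJ0 hIJ y _ hy => ⟨?_, ?_⟩,
    tendsto_decayRate⟩
  · exact marginalDensity_pos hβ.le hγ fun j hj => (hy j hj).1
  · exact abs_conditionalDensity_sub_marginalDensity_le hβ.le hγ hI hJ hI0 hJ0 hIJ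
      fun j hj => (hy j hj).1
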